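/- **Distance comparison in semigeodesic coordinates.** Let $\mathcal M$ be a compact $C^3$ manifold with boundary of dimension $m\ge 1$, let $\iota:\mathcal M\to\mathbb R^d$ be a $C^3$ embedding, and give $\mathcal M$ the metric pulled back by $\iota$. Let $\eta$ be the outward unit normal of $\partial\mathcal M$ and let $r>0$ be such that $\phi(y,s)=\exp_y(-s\eta_y)$ is a ($C^2$) diffeomorphism of $\partial\mathcal M\times[0,r)$ onto its image (a normal collar). For $0\le t<r$ let $\partial\mathcal M^t=\phi(\partial\mathcal M\times\{t\})$, the hypersurface of points at distance $t$ from $\partial\mathcal M$, with the induced metric, and let $\Pi_{\partial\mathcal M^t}$ be its second fundamental form as a hypersurface of $\mathcal M$, that is, $\Pi_{\partial\mathcal M^t}(X,Y)=(\nabla_XY)^\perp$, where $\nabla$ is the Levi-Civita connection of $\mathcal M$ and $\perp$ is the component orthogonal to $T\partial\mathcal M^t$. Let $x\in\partial\mathcal M^t$ and let $e_1,\dots,e_{m-1}$ be an orthonormal basis of $T_x\partial\mathcal M^t$. The point with semigeodesic coordinates $u=(u^1,\dots,u^m)$ centred at $x$ is reached by going from $x$ to $\exp^{\partial\mathcal M^t}_x\big(\sum_{i<m}u^ie_i\big)=\phi(y_u,t)$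 with $y_u\in\partial\mathcal M$, and then along the inward normal geodesic to $\phi(y_u,t+u^m)$; here $u$ runs over a cylinder $D=\{\,\|(u^1,\dots,u^{m-1})\|<\rho,\ |u^m|<h,\ 0\le t+u^m<r\,\}$ with $\rho,h>0$ on which this is injective. Write $\iota(u)$ for the image of this point under $\iota$, with $\iota(x)$ taken as the origin of $\mathbb R^d$, and $\|u\|$ for the Euclidean norm of $u$. For a vector $w\in\mathbb R^m$ let $W=\sum_i w^i\partial_i\in T_x\mathcal M$ and decompose it as $W=W^\top+W^\perp$ with $W^\top=\sum_{i<m}w^i\partial_i=\sum_{i<m}w^ie_i$ and $W^\perp=w^m\partial_m$, where $\partial_m$ is the velocity of the inward normal geodesic through $x$. Then, as $u\to0$ in $D\setminus\{0\}$, $$\frac{\|\iota(u)\|^2-\|u\|^2}{\|u\|^3}+\big\langle\Pi_{\partial\mathcal M^t}(\widehat U^\top,\widehat U^\top),\widehat U^\perp\big\rangle\longrightarrow0,$$ where $\widehat U$ is the vector with components $\hat u=u/\|u\|$. In particular, for every unit vector $w\in\mathbb R^m$ (with $w^m\ge0$ if $t=0$), $$\lim_{s\to0^+}\frac{\|\iota(sw)\|^2-\|sw\|^2}{\|sw\|^3}=-\big\langle\Pi_{\partial\mathcal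 M^t}(W^\top,W^\top),W^\perp\big\rangle .$$ -/

import Mathlib

open Set Filter Topology
open scoped Manifold ContDiff InnerProductSpace

noncomputable section

namespace Semigeodesic

/-! ### Riemannian geometry of the metric induced by a parametrization -/

section Param

variable {k d : ℕ}

/-- First fundamental form at `z` of a parametrization `F`, defined on `S ⊆ ℝᵏ`: the coordinate
expression `g(v, w)` of the pullback to `S` of the Euclidean metric of `ℝᵈ`. -/
def metric (F : EuclideanSpace ℝ (Fin k) → EuclideanSpace ℝ (Fin d))
    (S : Set (EuclideanSpace ℝ (Fin k))) (z v w : EuclideanSpace ℝ (Fin k)) : ℝ :=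
  ⟪fderivWithin ℝ F S z v, fderivWithin ℝ F S z w⟫_ℝ

/-- The matrix `g_{ij}(z)` of the metric. -/
def gram (F : EuclideanSpace ℝ (Fin k) → EuclideanSpace ℝ (Fin d))
    (S : Set (EuclideanSpace ℝ (Fin k))) (z : EuclideanSpace ℝ (Fin k)) :
    Matrix (Fin k) (Fin k) ℝ :=
  Matrix.of fun i j =>
    metric F S z (EuclideanSpace.single i (1 : ℝ)) (EuclideanSpace.single j (1 : ℝ))

/-- Christoffel symbols of the first kind, contracted with constant coordinate vectors `a, b, w`:
`½ (∂_a g(b, w) + ∂_b g(a, w) - ∂_w g(a, b))`. -/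
def christoffelLower (F : EuclideanSpace ℝ (Fin k) → EuclideanSpace ℝ (Fin d))
    (S : Set (EuclideanSpace ℝ (Fin k))) (z a b w : EuclideanSpace ℝ (Fin k)) : ℝ :=
  (fderivWithin ℝ (fun z' => metric F S z' b w) S z a
    + fderivWithin ℝ (fun z' => metric F S z' a w) S z b
    - fderivWithin ℝ (fun z' => metric F S z' a b) S z w) / 2

/-- Christoffel symbols of the Levi-Civita connection: the vector with components
`∑ i j, Γ^l_{ij} a^i b^j`. -/
def christoffel (F : EuclideanSpace ℝ (Fin k) → EuclideanSpace ℝ (Fin d))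
    (S : Set (EuclideanSpace ℝ (Fin k))) (z a b : EuclideanSpace ℝ (Fin k)) :
    EuclideanSpace ℝ (Fin k) :=
  WithLp.toLp 2 fun l => ∑ q, (gram F S z)⁻¹ l q *
    christoffelLower F S z a b (EuclideanSpace.single q (1 : ℝ))

/-- Coordinates `c'' + Γ(c', c')` of the covariant acceleration at time `s ∈ J` of the curve with
coordinates `c`. -/
def covAccel (F : EuclideanSpace ℝ (Fin k) → EuclideanSpace ℝ (Fin d))
    (S : Set (EuclideanSpace ℝ (Fin k))) (c : ℝ → EuclideanSpace ℝ (Fin k)) (J : Set ℝ) (s : ℝ) :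
    EuclideanSpace ℝ (Fin k) :=
  derivWithin (derivWithin c J) J s
    + christoffel F S (c s) (derivWithin c J s) (derivWithin c J s)

end Param

/-- The inclusion `z ↦ (0, z)` of `ℝⁿ` as the boundary of the half-space `{x₀ ≥ 0} ⊆ ℝⁿ⁺¹`. -/
def bdryIncl {n : ℕ} (z : EuclideanSpace ℝ (Fin n)) : EuclideanSpace ℝ (Fin (n + 1)) :=
  WithLp.toLp 2 (Fin.cons 0 (fun i => z i) : Fin (n + 1) → ℝ)

/-- The projection `(x₀, z) ↦ z`. -/
def bdryProj {n : ℕ} (x : EuclideanSpace ℝ (Fin (n + 1))) : EuclideanSpace ℝ (Fin n) :=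
  WithLp.toLp 2 fun i => x i.succ

/-! ### The manifold, its normal collar and the hypersurfaces `∂M^t` -/

section Manifold

variable {n d : ℕ} {M : Type*} [TopologicalSpace M] [ChartedSpace (EuclideanHalfSpace (n + 1)) M]

/-- `ι` is a `C^3` embedding of `M` in `ℝᵈ`. The Riemannian metric of `M` is always the one
pulled back by `ι`. -/
structure IsC3Embedding (ι : M → EuclideanSpace ℝ (Fin d)) : Prop where
  contMDiff : ContMDiff (𝓡∂ (n + 1)) 𝓘(ℝ, EuclideanSpace ℝ (Fin d)) 3 ι
  isEmbedding : IsEmbedding ι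
  injective_mfderiv : ∀ p : M,
    Function.Injective (mfderiv (𝓡∂ (n + 1)) 𝓘(ℝ, EuclideanSpace ℝ (Fin d)) ι p)

/-- The inverse of the chart around `p`, composed with `ι`; it is a parametrization on the
half-space `range (𝓡∂ (n + 1))`. -/
def chartParam (ι : M → EuclideanSpace ℝ (Fin d)) (p : M) :
    EuclideanSpace ℝ (Fin (n + 1)) → EuclideanSpace ℝ (Fin d) :=
  fun z => ι ((extChartAt (𝓡∂ (n + 1)) p).symm z)

/-- `γ` is a geodesic of `M` on the interval `J`: it is `C^2` and satisfies
`c'' + Γ(c', c') = 0` in the coordinates of every chart. -/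
def IsGeodesicOn (ι : M → EuclideanSpace ℝ (Fin d)) (γ : ℝ → M) (J : Set ℝ) : Prop :=
  ContMDiffOn 𝓘(ℝ, ℝ) (𝓡∂ (n + 1)) 2 γ J ∧
  ∀ p : M, ∀ s ∈ J, γ s ∈ (extChartAt (𝓡∂ (n + 1)) p).source →
    covAccel (chartParam (n := n) ι p) (range (𝓡∂ (n + 1)))
      (fun s' => extChartAt (𝓡∂ (n + 1)) p (γ s')) J s = 0

/-- Given in the chart around the boundary point `y`, the vector `v` is the inward-pointing unit
normal `-η_y` of `∂M` (in this chart `T_y ∂M = {w | w₀ = 0}`). -/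
def IsInwardUnitNormal (ι : M → EuclideanSpace ℝ (Fin d)) (y : M)
    (v : EuclideanSpace ℝ (Fin (n + 1))) : Prop :=
  metric (chartParam (n := n) ι y) (range (𝓡∂ (n + 1))) (extChartAt (𝓡∂ (n + 1)) y y) v v = 1 ∧
  (∀ w : EuclideanSpace ℝ (Fin (n + 1)), w 0 = 0 →
    metric (chartParam (n := n) ι y) (range (𝓡∂ (n + 1))) (extChartAt (𝓡∂ (n + 1)) y y) v w = 0) ∧
  0 < v 0

/-- The boundary coordinates, in the chart around `p`, of a point `y ∈ ∂M`. -/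
def bdryCoord (p y : M) : EuclideanSpace ℝ (Fin n) :=
  bdryProj (extChartAt (𝓡∂ (n + 1)) p y)

/-- The point of `∂M` with boundary coordinates `z` in the chart around `p`. -/
def bdryPoint (p : M) (z : EuclideanSpace ℝ (Fin n)) : M :=
  (extChartAt (𝓡∂ (n + 1)) p).symm (bdryIncl z)

/-- The boundary coordinates `z` that the chart around `p` covers. -/
def bdryTarget (p : M) : Set (EuclideanSpace ℝ (Fin n)) :=
  {z | bdryIncl z ∈ (extChartAt (𝓡∂ (n + 1)) p).target}

/-- `φ : ∂M × [0, r) → M` is the normal collar `φ(y, s) = exp_y(-s η_y)` of width `r`, and it is a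
diffeomorphism onto its image. -/
structure IsNormalCollar (ι : M → EuclideanSpace ℝ (Fin d)) (r : ℝ) (φ : M → ℝ → M) : Prop where
  pos : 0 < r
  isGeodesicOn : ∀ y ∈ (𝓡∂ (n + 1)).boundary M, IsGeodesicOn (n := n) ι (φ y) (Ico 0 r)
  start : ∀ y ∈ (𝓡∂ (n + 1)).boundary M, φ y 0 = y
  velocity : ∀ y ∈ (𝓡∂ (n + 1)).boundary M, IsInwardUnitNormal (n := n) ι y
    (derivWithin (fun s => extChartAt (𝓡∂ (n + 1)) y (φ y s)) (Ico 0 r) 0)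
  injOn : InjOn (fun q : M × ℝ => φ q.1 q.2) ((𝓡∂ (n + 1)).boundary M ×ˢ Ico 0 r)
  contMDiffOn : ∀ p : M,
    ContMDiffOn 𝓘(ℝ, EuclideanSpace ℝ (Fin n) × ℝ) (𝓡∂ (n + 1)) 2
      (fun q : EuclideanSpace ℝ (Fin n) × ℝ => φ (bdryPoint (n := n) p q.1) q.2)
      (bdryTarget p ×ˢ Ico 0 r)
  injective_deriv : ∀ p : M, ∀ q ∈ bdryTarget p ×ˢ Ico 0 r,
    Function.Injective (fderivWithin ℝ
      (fun q : EuclideanSpace ℝ (Fin n) × ℝ => ι (φ (bdryPoint (n := n) p q.1) q.2))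
      (bdryTarget p ×ˢ Ico 0 r) q)

/-- The hypersurface `∂M^t` is `φ(∂M × {t})`, the set of points at distance `t` from `∂M`. Boundary
coordinates `z` in the chart around `p` serve as coordinates of `∂M^t`: they give the point
`φ(y, t)`, where `y ∈ ∂M` has boundary coordinates `z`. -/
def levelPoint (φ : M → ℝ → M) (t : ℝ) (p : M) (z : EuclideanSpace ℝ (Fin n)) : M :=
  φ (bdryPoint (n := n) p z) t

/-- The parametrization of `∂M^t ⊆ ℝᵈ` by these coordinates. -/
def levelParam (ι : M → EuclideanSpace ℝ (Fin d)) (φ : M → ℝ → M) (t : ℝ) (p : M) :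
    EuclideanSpace ℝ (Fin n) → EuclideanSpace ℝ (Fin d) :=
  fun z => ι (levelPoint (n := n) φ t p z)

/-- For a curve `b` in `∂M`, the curve `s ↦ φ(b(s), t)` is a geodesic of `∂M^t`, with its induced
metric, on the interval `J`: it is `C^2` and satisfies `c'' + Γ(c', c') = 0` in the coordinates of
`∂M^t` that come from any chart. -/
def IsLevelGeodesicOn (ι : M → EuclideanSpace ℝ (Fin d)) (φ : M → ℝ → M) (t : ℝ) (b : ℝ → M)
    (J : Set ℝ) : Prop :=
  (∀ s ∈ J, b s ∈ (𝓡∂ (n + 1)).boundary M) ∧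
  ContMDiffOn 𝓘(ℝ, ℝ) (𝓡∂ (n + 1)) 2 b J ∧
  ∀ p : M, ∀ s ∈ J, b s ∈ (extChartAt (𝓡∂ (n + 1)) p).source →
    covAccel (levelParam (n := n) ι φ t p) univ (fun s' => bdryCoord (n := n) p (b s')) J s = 0

/-- For vectors `a, b` tangent to `∂M^t` at `x = φ(y, t)`, given in the coordinates of `∂M^t` from
the chart around `y`, extended with constant components: the covariant derivative `∇_a b` of `M`,
in the chart of `M` around `x`. -/
def levelNabla (ι : M → EuclideanSpace ℝ (Fin d)) (φ : M → ℝ → M) (t : ℝ) (y : M)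
    (a b : EuclideanSpace ℝ (Fin n)) : EuclideanSpace ℝ (Fin (n + 1)) :=
  let σ : EuclideanSpace ℝ (Fin n) → EuclideanSpace ℝ (Fin (n + 1)) :=
    fun z => extChartAt (𝓡∂ (n + 1)) (φ y t) (levelPoint (n := n) φ t y z)
  let z₀ : EuclideanSpace ℝ (Fin n) := bdryCoord (n := n) y y
  fderiv ℝ (fun z => fderiv ℝ σ z b) z₀ a
    + christoffel (chartParam (n := n) ι (φ y t)) (range (𝓡∂ (n + 1))) (σ z₀)
        (fderiv ℝ σ z₀ a) (fderiv ℝ σ z₀ b)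

/-- The second fundamental form `Π(a, b) = (∇_a b)^⊥` at `x = φ(y, t)` of `∂M^t` as a hypersurface
of `M`: the component of `∇_a b ∈ T_x M` orthogonal to `T_x ∂M^t`. Vectors of `T_x M` are written
as vectors of `ℝᵈ` through the isometry `dι`. -/
def secondFundForm (ι : M → EuclideanSpace ℝ (Fin d)) (φ : M → ℝ → M) (t : ℝ) (y : M)
    (a b : EuclideanSpace ℝ (Fin n)) : EuclideanSpace ℝ (Fin d) :=
  let T : Submodule ℝ (EuclideanSpace ℝ (Fin d)) :=
    LinearMap.range (fderiv ℝ (levelParam (n := n) ι φ t y) (bdryCoord (n := n) y y)).toLinearMap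
  Tᗮ.starProjection
    (fderivWithin ℝ (chartParam (n := n) ι (φ y t)) (range (𝓡∂ (n + 1)))
      (extChartAt (𝓡∂ (n + 1)) (φ y t) (φ y t)) (levelNabla ι φ t y a b))

/-- The coordinate vector `∂_m` at `x = φ(y, t)`, as a vector of `ℝᵈ`: the velocity of the normal
geodesic `s ↦ φ(y, s)` at `s = t`. -/
def normalVec (ι : M → EuclideanSpace ℝ (Fin d)) (r : ℝ) (φ : M → ℝ → M) (t : ℝ) (y : M) :
    EuclideanSpace ℝ (Fin d) :=
  derivWithin (fun s => ι (φ y s)) (Ico 0 r) t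

/-! ### Semigeodesic coordinates -/

/-- The first `m - 1` coordinates `(u¹, …, u^{m-1})` of `u`, where `m = n + 1`. -/
def tang (u : EuclideanSpace ℝ (Fin (n + 1))) : EuclideanSpace ℝ (Fin n) :=
  WithLp.toLp 2 fun i => u i.castSucc

/-- The last coordinate `u^m`. -/
def height (u : EuclideanSpace ℝ (Fin (n + 1))) : ℝ := u (Fin.last n)

/-- The cylinder of radius `ρ` and height `h`, truncated to `-t ≤ u^m` by the boundary and to
`u^m < r - t` by the collar. -/
def cylinder (n : ℕ) (r t ρ h : ℝ) : Set (EuclideanSpace ℝ (Fin (n + 1))) :=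
  {u | ‖tang u‖ < ρ ∧ |height u| < h ∧ t + height u ∈ Ico 0 r}

/-- The point with semigeodesic coordinates `u`: from the point `φ(β(u¹, …, u^{m-1}), t)` of
`∂M^t`, move by `u^m` along the normal geodesic. -/
def semigeodesicPoint (φ : M → ℝ → M) (t : ℝ) (β : EuclideanSpace ℝ (Fin n) → M)
    (u : EuclideanSpace ℝ (Fin (n + 1))) : M :=
  φ (β (tang u)) (t + height u)

/-- The vector `∑ vⁱ eᵢ`. -/
def frameVec (e : Fin n → EuclideanSpace ℝ (Fin n)) (v : EuclideanSpace ℝ (Fin n)) :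
    EuclideanSpace ℝ (Fin n) :=
  ∑ i, v i • e i

/-- `semigeodesicPoint φ t β` on `cylinder n r t ρ h` is a system of semigeodesic coordinates
centred at `x = φ(y, t)` in the normal collar `φ` of width `r`. Here `v ↦ φ(β(v), t)` are normal
coordinates of `∂M^t` centred at `x`, that is `v ↦ exp_x(∑ vⁱ eᵢ)` with the exponential map of
`∂M^t` and an orthonormal basis `e` of `T_x ∂M^t` (written in the coordinates of `∂M^t` that come
from the chart around `y`). -/
structure IsSemigeodesic (ι : M → EuclideanSpace ℝ (Fin d)) (r : ℝ) (φ : M → ℝ → M) (t : ℝ)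
    (y : M) (ρ h : ℝ) (e : Fin n → EuclideanSpace ℝ (Fin n))
    (β : EuclideanSpace ℝ (Fin n) → M) : Prop where
  radius_pos : 0 < ρ
  height_pos : 0 < h
  orthonormal : ∀ i j, metric (levelParam (n := n) ι φ t y) univ (bdryCoord (n := n) y y) (e i) (e j)
    = if i = j then 1 else 0
  center : β 0 = y
  isLevelGeodesicOn : ∀ v : EuclideanSpace ℝ (Fin n), ‖v‖ < ρ →
    IsLevelGeodesicOn (n := n) ι φ t (fun s => β (s • v)) (Icc 0 1)
  velocity : ∀ v : EuclideanSpace ℝ (Fin n), ‖v‖ < ρ →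
    derivWithin (fun s : ℝ => bdryCoord (n := n) y (β (s • v))) (Icc 0 1) 0 = frameVec e v
  injOn : InjOn (semigeodesicPoint φ t β) (cylinder n r t ρ h)

/-- `⟨Π_{∂M^t}(U^⊤, U^⊤), U^⊥⟩` at `x = φ(y, t)` for the tangent vector `U = ∑ uⁱ ∂ᵢ` with
semigeodesic components `u`: `U^⊤ = ∑_{i<m} uⁱ eᵢ` and `U^⊥ = u^m ∂_m`. -/
def cubicTerm (ι : M → EuclideanSpace ℝ (Fin d)) (r : ℝ) (φ : M → ℝ → M) (t : ℝ) (y : M)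
    (e : Fin n → EuclideanSpace ℝ (Fin n)) (u : EuclideanSpace ℝ (Fin (n + 1))) : ℝ :=
  ⟪secondFundForm ι φ t y (frameVec e (tang u)) (frameVec e (tang u)),
    height u • normalVec ι r φ t y⟫_ℝ

/-- The quotient `(‖ι(u)‖² - ‖u‖²) / ‖u‖³`, with `ι(x)` as the origin of `ℝᵈ`. -/
def distQuotient (ι : M → EuclideanSpace ℝ (Fin d)) (φ : M → ℝ → M) (t : ℝ) (y : M)
    (β : EuclideanSpace ℝ (Fin n) → M) (u : EuclideanSpace ℝ (Fin (n + 1))) : ℝ :=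
  (‖ι (semigeodesicPoint φ t β u) - ι (φ y t)‖ ^ 2 - ‖u‖ ^ 2) / ‖u‖ ^ 3

end Manifold

end Semigeodesic

end

/-!
The point with semigeodesic coordinates `u = (v, h)` has image `Φ(b(v), t + h)` in `ℝᵈ`, where
`Φ(z, s) = ι(φ(z, s))` is the collar in boundary coordinates (`collarParam`), a `C²` map, and `b(v)`
are the boundary coordinates of the endpoint of the geodesic of `∂M^t` with initial velocity
`a = ∑ vⁱ eᵢ`. Because the first order term of the position has norm exactly `‖u‖`, a second order
expansion of the position gives the squared distance up to `o(‖u‖³)`: if the position is `P + Q` up to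
`o(‖u‖²)`, with `P` linear and `Q` quadratic, then its square is `‖P‖² + 2⟨P, Q⟩ + o(‖u‖³)`.

The metric of `∂M^t` is only `C¹`, so its geodesics solve an equation `c'' = -Γ(c)(c', c')` with merely
continuous coefficients and `b` need not be `C²`. A direct estimate of the solutions, for which no
uniqueness is needed, still gives `b(v) = b(0) + a - ½ Γ(a, a) + o(‖v‖²)`
(`IsSemigeodesic.eventually_expansion`). Since `β` is not assumed continuous, the estimate includes a
continuity argument that keeps each geodesic in the chart (`mem_of_continuousOn_of_bootstrap`).

With `N = Φ_s` and `A = Φ_z a` this yields `P = A + h N` and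
`2 Q = (Φ_zz(a, a) - Φ_z Γ(a, a)) + 2 h Φ_zs a + h² Φ_ss`. The following facts evaluate `2⟨P, Q⟩`.
* A geodesic of a submanifold of `ℝᵈ` has normal acceleration, so `Φ_ss` is orthogonal to `M`, and
  `Φ_zz(a, a) - Φ_z Γ(a, a)` is orthogonal to `∂M^t`. Both come from the Koszul formula
  (`christoffelLower_eq_inner`, `inner_sub_christoffel_eq_zero`).
* `‖N‖ = 1` and `N` is orthogonal to the level hypersurfaces (the Gauss lemma,
  `IsNormalCollar.inner_normal_tangent`).
* Differentiating these two identities along `∂M^t` gives `⟨N, Φ_zs a⟩ = 0` and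
  `⟨A, Φ_zs a⟩ = -⟨N, Φ_zz(a, a)⟩`.
Hence `2⟨P, Q⟩ = h⟨N, Φ_zz(a, a)⟩ - 2 h⟨N, Φ_zz(a, a)⟩ = -h⟨N, Φ_zz(a, a)⟩`, and by the Gauss formula
`⟨N, Φ_zz(a, a)⟩ = ⟨Π(a, a), N⟩` (`IsNormalCollar.inner_secondFundForm`).
-/

namespace Semigeodesic

/-! ### Second derivatives of compositions -/

section SecondDerivative

variable {E E' V : Type*} [NormedAddCommGroup E] [NormedSpace ℝ E] [NormedAddCommGroup E']
  [NormedSpace ℝ E'] [NormedAddCommGroup V] [NormedSpace ℝ V]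

lemma hasFDerivWithinAt_fderivWithin {F : E → V} {S : Set E} {z : E} (hS : UniqueDiffOn ℝ S)
    (hz : z ∈ S) (hF : ContDiffWithinAt ℝ 2 F S z) :
    HasFDerivWithinAt (fderivWithin ℝ F S) (fderivWithin ℝ (fderivWithin ℝ F S) S z) S z :=
  ((hF.fderivWithin_right (m := 1) hS (by norm_num) hz).differentiableWithinAt
    (by norm_num)).hasFDerivWithinAt

lemma fderivWithin_fderivWithin_symm {F : E → V} {S : Set E} {z : E} (hS : UniqueDiffOn ℝ S)
    (hz : z ∈ S) (hzc : z ∈ closure (interior S)) (hF : ContDiffWithinAt ℝ 2 F S z) (a b : E) :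
    fderivWithin ℝ (fderivWithin ℝ F S) S z a b = fderivWithin ℝ (fderivWithin ℝ F S) S z b a :=
  hF.isSymmSndFDerivWithinAt (by simp [minSmoothness_of_isRCLikeNormedField]) hS hzc hz a b

/-- The chain rule within sets, where `σ` need only map into `S` near the point. -/
lemma fderivWithin_comp_of_eventually_mem {F : E → V} {σ : E' → E} {S : Set E} {T : Set E'} {x : E'}
    (hT : UniqueDiffOn ℝ T) (hx : x ∈ T) (hF : DifferentiableWithinAt ℝ F S (σ x))
    (hσ : DifferentiableWithinAt ℝ σ T x) (hm : ∀ᶠ x' in 𝓝[T] x, σ x' ∈ S) :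
    fderivWithin ℝ (fun x' => F (σ x')) T x
      = (fderivWithin ℝ F S (σ x)).comp (fderivWithin ℝ σ T x) :=
  (HasFDerivWithinAt.comp_of_tendsto x hF.hasFDerivWithinAt hσ.hasFDerivWithinAt
    (tendsto_nhdsWithin_iff.2 ⟨hσ.continuousWithinAt, hm⟩)).fderivWithin (hT x hx)

/-- The second derivative of a composition: `D²(F ∘ σ)(a, b) = D²F(σ'a, σ'b) + DF(σ''(a, b))`. -/
lemma fderivWithin_fderivWithin_comp {F : E → V} {σ : E' → E} {S : Set E} {T : Set E'} {x : E'}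
    (hS : UniqueDiffOn ℝ S) (hT : UniqueDiffOn ℝ T) (hx : x ∈ T)
    (hF : ContDiffWithinAt ℝ 2 F S (σ x)) (hσ : ContDiffWithinAt ℝ 2 σ T x)
    (hm : ∀ᶠ x' in 𝓝[T] x, σ x' ∈ S) (a b : E') :
    fderivWithin ℝ (fderivWithin ℝ (fun x' => F (σ x')) T) T x a b
      = fderivWithin ℝ (fderivWithin ℝ F S) S (σ x) (fderivWithin ℝ σ T x a)
          (fderivWithin ℝ σ T x b)
        + fderivWithin ℝ F S (σ x) (fderivWithin ℝ (fderivWithin ℝ σ T) T x a b) := by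
  have hxS : σ x ∈ S := hm.self_of_nhdsWithin hx
  have htend : Tendsto σ (𝓝[T] x) (𝓝[S] σ x) :=
    tendsto_nhdsWithin_iff.2 ⟨hσ.continuousWithinAt, hm⟩
  have h1 : ∀ᶠ x' in 𝓝[T] x, ContDiffWithinAt ℝ 2 F S (σ x') := by
    have := hF.eventually (by decide)
    rw [insert_eq_of_mem hxS] at this
    exact htend.eventually this
  have h2 : ∀ᶠ x' in 𝓝[T] x, ContDiffWithinAt ℝ 2 σ T x' := by
    have := hσ.eventually (by decide)
    rwa [insert_eq_of_mem hx] at this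
  have h3 : ∀ᶠ x' in 𝓝[T] x, fderivWithin ℝ (fun x' => F (σ x')) T x'
      = (fderivWithin ℝ F S (σ x')).comp (fderivWithin ℝ σ T x') := by
    filter_upwards [h1, h2, eventually_eventually_nhdsWithin.2 hm, self_mem_nhdsWithin]
      with x' e1 e2 e3 hx'
    exact fderivWithin_comp_of_eventually_mem hT hx' (e1.differentiableWithinAt (by norm_num))
      (e2.differentiableWithinAt (by norm_num)) e3
  have h4 : HasFDerivWithinAt (fun x' => (fderivWithin ℝ F S (σ x')).comp (fderivWithin ℝ σ T x'))
      _ T x := HasFDerivWithinAt.clm_comp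
    (HasFDerivWithinAt.comp_of_tendsto x (hasFDerivWithinAt_fderivWithin hS hxS hF)
      (hσ.differentiableWithinAt (by norm_num)).hasFDerivWithinAt htend)
    (hasFDerivWithinAt_fderivWithin hT hx hσ)
  rw [Filter.EventuallyEq.fderivWithin_eq h3 (h3.self_of_nhdsWithin hx), h4.fderivWithin (hT x hx)]
  simp [add_comm]

lemma hasDerivWithinAt_derivWithin {c : ℝ → E} {J : Set ℝ} {s : ℝ} (hJ : UniqueDiffOn ℝ J)
    (hs : s ∈ J) (hc : ContDiffWithinAt ℝ 2 c J s) :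
    HasDerivWithinAt (derivWithin c J) (derivWithin (derivWithin c J) J s) J s := by
  have h : HasFDerivWithinAt (derivWithin c J) _ J s :=
    (hasFDerivWithinAt_fderivWithin hJ hs hc).clm_apply (hasFDerivWithinAt_const (1 : ℝ) s J)
  exact h.differentiableWithinAt.hasDerivWithinAt

lemma derivWithin_derivWithin_eq {c : ℝ → E} {J : Set ℝ} {s : ℝ} (hJ : UniqueDiffOn ℝ J)
    (hs : s ∈ J) (hc : ContDiffWithinAt ℝ 2 c J s) :
    derivWithin (derivWithin c J) J s
      = fderivWithin ℝ (fderivWithin ℝ c J) J s 1 1 := by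
  have h := (hasFDerivWithinAt_fderivWithin hJ hs hc).clm_apply
    (hasFDerivWithinAt_const (1 : ℝ) s J)
  have h' : HasFDerivWithinAt (derivWithin c J) _ J s := h
  rw [← fderivWithin_derivWithin, h'.fderivWithin (hJ s hs)]
  simp

/-- Second derivative of the restriction to an affine subspace. -/
lemma fderivWithin_fderivWithin_comp_affine {F : E → V} {S : Set E} {T : Set E'} {x : E'}
    {L : E' →L[ℝ] E} {w : E} (hS : UniqueDiffOn ℝ S) (hT : UniqueDiffOn ℝ T) (hx : x ∈ T)
    (hF : ContDiffWithinAt ℝ 2 F S (w + L x)) (hm : ∀ x' ∈ T, w + L x' ∈ S) (a b : E') :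
    fderivWithin ℝ (fun x' => F (w + L x')) T x a = fderivWithin ℝ F S (w + L x) (L a) ∧
    fderivWithin ℝ (fderivWithin ℝ (fun x' => F (w + L x')) T) T x a b
      = fderivWithin ℝ (fderivWithin ℝ F S) S (w + L x) (L a) (L b) := by
  have hd : ∀ x' ∈ T, fderivWithin ℝ (fun x' => w + L x') T x' = L := fun x' hx' =>
    (L.hasFDerivAt.const_add w).hasFDerivWithinAt.fderivWithin (hT x' hx')
  have hc : ContDiffWithinAt ℝ 2 (fun x' => w + L x') T x :=
    (contDiff_const.add L.contDiff).contDiffWithinAt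
  have hm' : ∀ᶠ x' in 𝓝[T] x, w + L x' ∈ S := eventually_nhdsWithin_of_forall hm
  constructor
  · rw [fderivWithin_comp_of_eventually_mem (σ := fun x' => w + L x') hT hx
      (hF.differentiableWithinAt (by norm_num)) (hc.differentiableWithinAt (by norm_num)) hm',
      hd x hx]
    rfl
  · rw [fderivWithin_fderivWithin_comp (σ := fun x' => w + L x') hS hT hx hF hc hm', hd x hx,
      fderivWithin_congr hd (hd x hx)]
    simp

/-- The second derivative of a composition with a curve. -/
lemma derivWithin_derivWithin_comp {F : E → V} {c : ℝ → E} {S : Set E} {J : Set ℝ} {s : ℝ}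
    (hS : UniqueDiffOn ℝ S) (hJ : UniqueDiffOn ℝ J) (hs : s ∈ J)
    (hF : ContDiffWithinAt ℝ 2 F S (c s)) (hc : ContDiffWithinAt ℝ 2 c J s)
    (hm : ∀ᶠ s' in 𝓝[J] s, c s' ∈ S) :
    derivWithin (derivWithin (fun s' => F (c s')) J) J s
      = fderivWithin ℝ (fderivWithin ℝ F S) S (c s) (derivWithin c J s) (derivWithin c J s)
        + fderivWithin ℝ F S (c s) (derivWithin (derivWithin c J) J s) := by
  have hFc : ContDiffWithinAt ℝ 2 (fun s' => F (c s')) J s := by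
    have : ContDiffWithinAt ℝ 2 (fun s' => F (c s')) (J ∩ c ⁻¹' S) s := hF.comp_inter s hc
    refine this.mono_of_mem_nhdsWithin (inter_mem self_mem_nhdsWithin hm)
  rw [derivWithin_derivWithin_eq hJ hs hFc, derivWithin_derivWithin_eq hJ hs hc,
    fderivWithin_fderivWithin_comp hS hJ hs hF hc hm]
  rfl

/-- Derivative of the components `⟨DF(b), DF(w)⟩` of an induced metric. -/
lemma hasFDerivWithinAt_inner_fderivWithin {V : Type*} [NormedAddCommGroup V]
    [InnerProductSpace ℝ V] {F : E → V} {S : Set E} {z : E} (hS : UniqueDiffOn ℝ S) (hz : z ∈ S)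
    (hF : ContDiffWithinAt ℝ 2 F S z) (b w : E) :
    ∃ L : E →L[ℝ] ℝ,
      HasFDerivWithinAt (fun z' => ⟪fderivWithin ℝ F S z' b, fderivWithin ℝ F S z' w⟫_ℝ) L S z ∧
      ∀ a, L a = ⟪fderivWithin ℝ (fderivWithin ℝ F S) S z a b, fderivWithin ℝ F S z w⟫_ℝ
        + ⟪fderivWithin ℝ F S z b, fderivWithin ℝ (fderivWithin ℝ F S) S z a w⟫_ℝ := by
  have h := hasFDerivWithinAt_fderivWithin hS hz hF
  refine ⟨_, (h.clm_apply (hasFDerivWithinAt_const b z S)).inner ℝ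
    (h.clm_apply (hasFDerivWithinAt_const w z S)), fun a => ?_⟩
  simp [add_comm]

end SecondDerivative

/-! ### Christoffel symbols of an induced metric -/

section Christoffel

variable {k d : ℕ} {F : EuclideanSpace ℝ (Fin k) → EuclideanSpace ℝ (Fin d)}
  {S : Set (EuclideanSpace ℝ (Fin k))} {z : EuclideanSpace ℝ (Fin k)}

lemma fderivWithin_metric (hS : UniqueDiffOn ℝ S) (hz : z ∈ S) (hF : ContDiffWithinAt ℝ 2 F S z)
    (a b w : EuclideanSpace ℝ (Fin k)) :
    fderivWithin ℝ (fun z' => metric F S z' b w) S z a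
      = ⟪fderivWithin ℝ (fderivWithin ℝ F S) S z a b, fderivWithin ℝ F S z w⟫_ℝ
        + ⟪fderivWithin ℝ F S z b, fderivWithin ℝ (fderivWithin ℝ F S) S z a w⟫_ℝ := by
  obtain ⟨L, hL, hLa⟩ := hasFDerivWithinAt_inner_fderivWithin hS hz hF b w
  rw [← hLa, ← hL.fderivWithin (hS z hz)]
  rfl

/-- The Koszul formula for an induced metric: the Christoffel symbols of the first kind are the
tangential components of the second derivative. -/
lemma christoffelLower_eq_inner (hS : UniqueDiffOn ℝ S) (hz : z ∈ S)
    (hzc : z ∈ closure (interior S)) (hF : ContDiffWithinAt ℝ 2 F S z)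
    (a b w : EuclideanSpace ℝ (Fin k)) :
    christoffelLower F S z a b w
      = ⟪fderivWithin ℝ (fderivWithin ℝ F S) S z a b, fderivWithin ℝ F S z w⟫_ℝ := by
  have hs := fderivWithin_fderivWithin_symm hS hz hzc hF
  rw [christoffelLower, fderivWithin_metric hS hz hF, fderivWithin_metric hS hz hF,
    fderivWithin_metric hS hz hF, hs b a, hs w a, hs w b,
    real_inner_comm (fderivWithin ℝ (fderivWithin ℝ F S) S z a w),
    real_inner_comm (fderivWithin ℝ (fderivWithin ℝ F S) S z b w)]
  ring

/-- The map `ℝᵈ → ℝᵏ` taking a vector to the coordinates of its tangential component: pair with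
the coordinate vector fields and raise the index. -/
noncomputable def raise (F : EuclideanSpace ℝ (Fin k) → EuclideanSpace ℝ (Fin d))
    (S : Set (EuclideanSpace ℝ (Fin k))) (z : EuclideanSpace ℝ (Fin k)) :
    EuclideanSpace ℝ (Fin d) →L[ℝ] EuclideanSpace ℝ (Fin k) :=
  ∑ l, ∑ q, (gram F S z)⁻¹ l q •
    (innerSL ℝ (fderivWithin ℝ F S z (EuclideanSpace.single q 1))).smulRight
      (EuclideanSpace.single l (1 : ℝ))

lemma raise_apply (y : EuclideanSpace ℝ (Fin d)) (l : Fin k) :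
    raise F S z y l = ∑ q, (gram F S z)⁻¹ l q *
      ⟪y, fderivWithin ℝ F S z (EuclideanSpace.single q 1)⟫_ℝ := by
  simp [raise, Pi.single_apply, real_inner_comm y]

lemma christoffel_eq_raise (hS : UniqueDiffOn ℝ S) (hz : z ∈ S)
    (hzc : z ∈ closure (interior S)) (hF : ContDiffWithinAt ℝ 2 F S z)
    (a b : EuclideanSpace ℝ (Fin k)) :
    christoffel F S z a b = raise F S z (fderivWithin ℝ (fderivWithin ℝ F S) S z a b) := by
  ext l
  simp [christoffel, raise_apply, christoffelLower_eq_inner hS hz hzc hF]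

lemma gram_mulVec (v : EuclideanSpace ℝ (Fin k)) (q : Fin k) :
    (gram F S z).mulVec v q
      = ⟪fderivWithin ℝ F S z v, fderivWithin ℝ F S z (EuclideanSpace.single q 1)⟫_ℝ := by
  have hv : v = ∑ j, v j • EuclideanSpace.single j (1 : ℝ) := by
    ext i
    simp [Pi.single_apply]
  conv_rhs => rw [hv]
  simp only [map_sum, map_smul, sum_inner, inner_smul_left, Matrix.mulVec, dotProduct, gram,
    Matrix.of_apply, metric]
  refine Finset.sum_congr rfl fun j _ => ?_
  rw [real_inner_comm]
  simp [mul_comm]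

lemma eq_zero_of_forall_inner_single {y : EuclideanSpace ℝ (Fin d)}
    (h : ∀ q, ⟪y, fderivWithin ℝ F S z (EuclideanSpace.single q 1)⟫_ℝ = 0)
    (w : EuclideanSpace ℝ (Fin k)) : ⟪y, fderivWithin ℝ F S z w⟫_ℝ = 0 := by
  have hv : w = ∑ j, w j • EuclideanSpace.single j (1 : ℝ) := by
    ext i
    simp [Pi.single_apply]
  rw [hv]
  simp [map_sum, inner_sum, inner_smul_right, h]

lemma isUnit_det_gram (hinj : Function.Injective (fderivWithin ℝ F S z)) :
    IsUnit (gram F S z).det := by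
  rw [isUnit_iff_ne_zero]
  intro h0
  obtain ⟨v, hv, hv0⟩ := Matrix.exists_mulVec_eq_zero_iff.2 h0
  have h := eq_zero_of_forall_inner_single (F := F) (S := S) (z := z)
    (y := fderivWithin ℝ F S z (WithLp.toLp 2 v))
    (fun q => by rw [← gram_mulVec]; exact congrFun hv0 q) (WithLp.toLp 2 v)
  rw [inner_self_eq_zero, map_eq_zero_iff _ hinj] at h
  exact hv (by simpa using h)

lemma inner_fderivWithin_raise (hinj : Function.Injective (fderivWithin ℝ F S z))
    (y : EuclideanSpace ℝ (Fin d)) (w : EuclideanSpace ℝ (Fin k)) :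
    ⟪fderivWithin ℝ F S z (raise F S z y), fderivWithin ℝ F S z w⟫_ℝ
      = ⟪y, fderivWithin ℝ F S z w⟫_ℝ := by
  rw [← sub_eq_zero, ← inner_sub_left]
  refine eq_zero_of_forall_inner_single (fun q => ?_) w
  rw [inner_sub_left, ← gram_mulVec, sub_eq_zero]
  have h : (raise F S z y : Fin k → ℝ) = (gram F S z)⁻¹.mulVec
      (fun q => ⟪y, fderivWithin ℝ F S z (EuclideanSpace.single q 1)⟫_ℝ) := by
    ext l
    rw [raise_apply]
    rfl
  rw [h, Matrix.mulVec_mulVec, Matrix.mul_nonsing_inv _ (isUnit_det_gram hinj), Matrix.one_mulVec]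

/-- The Levi-Civita connection of an induced metric is the tangential part of the derivative in `ℝᵈ`. -/
lemma inner_sub_christoffel_eq_zero (hS : UniqueDiffOn ℝ S) (hz : z ∈ S)
    (hzc : z ∈ closure (interior S)) (hF : ContDiffWithinAt ℝ 2 F S z)
    (hinj : Function.Injective (fderivWithin ℝ F S z)) (a b w : EuclideanSpace ℝ (Fin k)) :
    ⟪fderivWithin ℝ (fderivWithin ℝ F S) S z a b - fderivWithin ℝ F S z (christoffel F S z a b),
      fderivWithin ℝ F S z w⟫_ℝ = 0 := by
  rw [christoffel_eq_raise hS hz hzc hF, inner_sub_left, inner_fderivWithin_raise hinj, sub_self]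

/-- The acceleration in `ℝᵈ` of a geodesic is normal to the submanifold. -/
lemma inner_derivWithin_derivWithin_eq_zero_of_covAccel {c : ℝ → EuclideanSpace ℝ (Fin k)}
    {J : Set ℝ} {s : ℝ} (hS : UniqueDiffOn ℝ S)
    (hzc : c s ∈ closure (interior S)) (hJ : UniqueDiffOn ℝ J) (hs : s ∈ J)
    (hF : ContDiffWithinAt ℝ 2 F S (c s)) (hc : ContDiffWithinAt ℝ 2 c J s)
    (hm : ∀ᶠ s' in 𝓝[J] s, c s' ∈ S) (hinj : Function.Injective (fderivWithin ℝ F S (c s)))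
    (hgeo : covAccel F S c J s = 0) (w : EuclideanSpace ℝ (Fin k)) :
    ⟪derivWithin (derivWithin (fun s' => F (c s')) J) J s, fderivWithin ℝ F S (c s) w⟫_ℝ = 0 := by
  rw [derivWithin_derivWithin_comp hS hJ hs hF hc hm,
    eq_neg_of_add_eq_zero_left (show _ + _ = _ from hgeo), map_neg, ← sub_eq_add_neg]
  exact inner_sub_christoffel_eq_zero hS (hm.self_of_nhdsWithin hs) hzc hF hinj _ _ _

lemma continuousWithinAt_raise (hF : ContinuousWithinAt (fderivWithin ℝ F S) S z)
    (hinj : Function.Injective (fderivWithin ℝ F S z)) :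
    ContinuousWithinAt (raise F S) S z := by
  have hg : ContinuousWithinAt (gram F S) S z :=
    continuousWithinAt_pi.2 fun i => continuousWithinAt_pi.2 fun j =>
      (hF.clm_apply continuousWithinAt_const).inner (hF.clm_apply continuousWithinAt_const)
  have hdet : ContinuousWithinAt (fun z => (gram F S z).det) S z :=
    (continuous_id.matrix_det.continuousAt (x := gram F S z)).comp_continuousWithinAt hg
  have hadj : ContinuousWithinAt (fun z => (gram F S z).adjugate) S z :=
    (continuous_id.matrix_adjugate.continuousAt (x := gram F S z)).comp_continuousWithinAt hg
  have hinv : ContinuousWithinAt (fun z => (gram F S z)⁻¹) S z := by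
    simp only [Matrix.inv_def, Ring.inverse_eq_inv']
    exact (hdet.inv₀ (isUnit_det_gram hinj).ne_zero).smul hadj
  have hent : ∀ l q, ContinuousWithinAt (fun z => (gram F S z)⁻¹ l q) S z := fun l q =>
    continuousWithinAt_pi.1 (continuousWithinAt_pi.1 hinv l) q
  have hone : ∀ l q, ContinuousWithinAt (fun z =>
      (innerSL ℝ (fderivWithin ℝ F S z (EuclideanSpace.single q 1))).smulRight
        (EuclideanSpace.single l (1 : ℝ))) S z := fun l q =>
    ((ContinuousLinearMap.smulRightL ℝ (EuclideanSpace ℝ (Fin d)) (EuclideanSpace ℝ (Fin k))).flip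
      (EuclideanSpace.single l (1 : ℝ))).continuous.continuousAt.comp_continuousWithinAt
      ((innerSL ℝ).continuous.continuousAt.comp_continuousWithinAt
        (hF.clm_apply continuousWithinAt_const))
  exact tendsto_finsetSum _ fun l _ => tendsto_finsetSum _ fun q _ => (hent l q).smul (hone l q)

end Christoffel

/-! ### Small solutions of the geodesic equation -/

section GeodesicEquation

variable {E : Type*} [NormedAddCommGroup E] [NormedSpace ℝ E]

/-- A priori bound for `c'' = -B(c)(c', c')` with `‖B‖ ≤ K`: a speed `α` with `4Kα < 1` at most
doubles in unit time. -/
lemma norm_le_of_quadratic_ode {B : E → E →L[ℝ] E →L[ℝ] E} {c p : ℝ → E} {K α τ : ℝ}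
    (hτ : τ ≤ 1) (hα : 0 < α) (hK : 4 * K * α < 1)
    (hc : ∀ s ∈ Icc 0 τ, HasDerivWithinAt c (p s) (Icc 0 τ) s)
    (hp : ∀ s ∈ Icc 0 τ, HasDerivWithinAt p (-(B (c s) (p s) (p s))) (Icc 0 τ) s)
    (hB : ∀ s ∈ Icc 0 τ, ‖B (c s)‖ ≤ K) (h0 : ‖p 0‖ ≤ α) :
    ∀ s ∈ Icc 0 τ, ‖p s‖ ≤ 2 * α ∧ ‖c s - c 0‖ ≤ 2 * α := by
  have hbound : ∀ s ∈ Icc 0 τ, ∀ β, ‖p s‖ ≤ β → ‖-(B (c s) (p s) (p s))‖ ≤ K * β ^ 2 := by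
    intro s hs β hβ
    rw [norm_neg]
    have hβ0 := (norm_nonneg _).trans hβ
    have hK0 := (norm_nonneg (B (c s))).trans (hB s hs)
    calc ‖B (c s) (p s) (p s)‖ ≤ ‖B (c s)‖ * ‖p s‖ * ‖p s‖ := (B (c s)).le_opNorm₂ _ _
      _ ≤ K * β * β := by gcongr; exact hB s hs
      _ = K * β ^ 2 := by ring
  have hspeed : ∀ s ∈ Icc 0 τ, ‖p s‖ ≤ α * (1 + s) := by
    -- Fencing by `α (1 + s)`: where the norm of `p` meets the fence, `p'` is smaller than `α`.
    refine image_norm_le_of_norm_deriv_right_lt_deriv_boundary (B' := fun _ => α)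
      (fun s hs => (hp s hs).continuousWithinAt)
      (fun s hs => (hp s (Ico_subset_Icc_self hs)).mono_of_mem_nhdsWithin
        (Icc_mem_nhdsGE_of_mem hs)) (by simpa using h0) (fun s => ?_) (fun s hs he => ?_)
    · simpa using ((hasDerivAt_id s).const_add 1).const_mul α
    · have h2 : ‖p s‖ ≤ 2 * α := by rw [he]; nlinarith [hs.2]
      refine (hbound s (Ico_subset_Icc_self hs) _ h2).trans_lt ?_
      nlinarith
  have hspeed' : ∀ s ∈ Icc 0 τ, ‖p s‖ ≤ 2 * α := fun s hs =>
    (hspeed s hs).trans (by nlinarith [hs.2])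
  refine fun s hs => ⟨hspeed' s hs, ?_⟩
  refine (norm_image_sub_le_of_norm_deriv_le_segment' hc
    (fun x hx => hspeed' x (Ico_subset_Icc_self hx)) s hs).trans ?_
  nlinarith [hs.2, hs.1]

/-- Second order expansion at time one of a solution of `c'' = -B(c)(c', c')` with small initial
speed. -/
lemma norm_expansion_le_of_quadratic_ode {B : E → E →L[ℝ] E →L[ℝ] E} {B₀ : E →L[ℝ] E →L[ℝ] E}
    {c p : ℝ → E} {K α ε : ℝ} (hα : 0 < α) (hK : 4 * K * α < 1)
    (hc : ∀ s ∈ Icc (0 : ℝ) 1, HasDerivWithinAt c (p s) (Icc 0 1) s)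
    (hp : ∀ s ∈ Icc (0 : ℝ) 1, HasDerivWithinAt p (-(B (c s) (p s) (p s))) (Icc 0 1) s)
    (hB : ∀ s ∈ Icc (0 : ℝ) 1, ‖B (c s)‖ ≤ K) (h0 : ‖p 0‖ ≤ α) (hB₀ : ‖B₀‖ ≤ K)
    (hε : ∀ s ∈ Icc (0 : ℝ) 1, ‖B (c s) - B₀‖ ≤ ε) :
    ‖c 1 - (c 0 + p 0 - (1 / 2 : ℝ) • B₀ (p 0) (p 0))‖ ≤ (4 * ε + 12 * K ^ 2 * α) * α ^ 2 := by
  have hap := norm_le_of_quadratic_ode le_rfl hα hK hc hp hB h0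
  have hK0 : 0 ≤ K := (norm_nonneg B₀).trans hB₀
  have hε0 : 0 ≤ ε := (norm_nonneg (B (c 0) - B₀)).trans (hε 0 (by simp))
  have hdp : ∀ s ∈ Icc (0 : ℝ) 1, ‖p s - p 0‖ ≤ 4 * K * α ^ 2 := by
    intro s hs
    refine (norm_image_sub_le_of_norm_deriv_le_segment' (C := 4 * K * α ^ 2) hp
      (fun x hx => ?_) s hs).trans ?_
    · have hx' := Ico_subset_Icc_self hx
      rw [norm_neg]
      calc ‖B (c x) (p x) (p x)‖ ≤ ‖B (c x)‖ * ‖p x‖ * ‖p x‖ := (B (c x)).le_opNorm₂ _ _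
        _ ≤ K * (2 * α) * (2 * α) := by
          gcongr
          exacts [hB x hx', (hap x hx').1, (hap x hx').1]
        _ = 4 * K * α ^ 2 := by ring
    · have : 0 ≤ 4 * K * α ^ 2 := by positivity
      nlinarith [hs.2, hs.1]
  set C := (4 * ε + 12 * K ^ 2 * α) * α ^ 2 with hC
  have hC0 : 0 ≤ C := by positivity
  -- The remainder of the velocity vanishes at time zero and has derivative bounded by `C`.
  have hq : ∀ s ∈ Icc (0 : ℝ) 1, HasDerivWithinAt (fun s => p s - p 0 + s • B₀ (p 0) (p 0))
      (-(B (c s) (p s) (p s)) + B₀ (p 0) (p 0)) (Icc 0 1) s := fun s hs => by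
    simpa using ((hp s hs).sub_const (p 0)).fun_add
      ((hasDerivWithinAt_id s _).smul_const (B₀ (p 0) (p 0)))
  have hq' : ∀ s ∈ Icc (0 : ℝ) 1, ‖-(B (c s) (p s) (p s)) + B₀ (p 0) (p 0)‖ ≤ C := by
    intro s hs
    have e : -(B (c s) (p s) (p s)) + B₀ (p 0) (p 0)
        = -((B (c s) - B₀) (p s) (p s)) - B₀ (p s - p 0) (p s) - B₀ (p 0) (p s - p 0) := by
      simp only [map_sub, sub_apply]
      abel
    rw [e]
    have h1 : ‖(B (c s) - B₀) (p s) (p s)‖ ≤ ε * (2 * α) * (2 * α) := by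
      refine ((B (c s) - B₀).le_opNorm₂ _ _).trans ?_
      gcongr
      exacts [hε s hs, (hap s hs).1, (hap s hs).1]
    have h2 : ‖B₀ (p s - p 0) (p s)‖ ≤ K * (4 * K * α ^ 2) * (2 * α) := by
      refine (B₀.le_opNorm₂ _ _).trans ?_
      gcongr
      exacts [hdp s hs, (hap s hs).1]
    have h3 : ‖B₀ (p 0) (p s - p 0)‖ ≤ K * α * (4 * K * α ^ 2) := by
      refine (B₀.le_opNorm₂ _ _).trans ?_
      gcongr
      exact hdp s hs
    refine (norm_sub_le _ _).trans ((add_le_add ((norm_sub_le _ _).trans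
      (add_le_add ((norm_neg _).trans_le h1) h2)) h3).trans (le_of_eq ?_))
    rw [hC]; ring
  have hr : ∀ s ∈ Icc (0 : ℝ) 1, ‖p s - p 0 + s • B₀ (p 0) (p 0)‖ ≤ C := by
    intro s hs
    have := norm_image_sub_le_of_norm_deriv_le_segment' hq
      (fun x hx => hq' x (Ico_subset_Icc_self hx)) s hs
    simp only [sub_self, zero_smul, add_zero, sub_zero] at this
    exact this.trans (by nlinarith [hs.2])
  have hg : ∀ s ∈ Icc (0 : ℝ) 1,
      HasDerivWithinAt (fun s => c s - s • p 0 + (s ^ 2 / 2) • B₀ (p 0) (p 0))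
        (p s - p 0 + s • B₀ (p 0) (p 0)) (Icc 0 1) s := fun s hs => by
    have h2 : HasDerivWithinAt (fun s : ℝ => s ^ 2 / 2) s (Icc 0 1) s := by
      simpa using ((hasDerivAt_pow 2 s).div_const 2).hasDerivWithinAt
    simpa using ((hc s hs).fun_sub ((hasDerivWithinAt_id s _).smul_const (p 0))).fun_add
      (h2.smul_const (B₀ (p 0) (p 0)))
  have := norm_image_sub_le_of_norm_deriv_le_segment' hg
    (fun x hx => hr x (Ico_subset_Icc_self hx)) 1 (by simp)
  simp only [one_smul, one_pow, zero_smul, sub_zero, mul_one] at this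
  convert this using 2
  simp
  abel

/-- Continuous induction along a path: if the path starts in the open set `O`, and lies in `O` at
any time up to which it has stayed in the closed set `K ⊇ O`, then it never leaves `O`. -/
lemma mem_of_continuousOn_of_bootstrap {X : Type*} [TopologicalSpace X] {γ : ℝ → X} {K O : Set X}
    (hγ : ContinuousOn γ (Icc 0 1)) (hK : IsClosed K) (hO : IsOpen O) (h0 : γ 0 ∈ O)
    (hOK : ∀ s ∈ Icc (0 : ℝ) 1, γ s ∈ O → γ s ∈ K)
    (hstep : ∀ τ ∈ Icc (0 : ℝ) 1, (∀ s ∈ Icc 0 τ, γ s ∈ K) → γ τ ∈ O) :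
    ∀ s ∈ Icc (0 : ℝ) 1, γ s ∈ O := by
  by_contra! hne
  have hcl : IsClosed (Icc (0 : ℝ) 1 ∩ γ ⁻¹' Oᶜ) :=
    hγ.preimage_isClosed_of_isClosed isClosed_Icc hO.isClosed_compl
  obtain ⟨m, ⟨hm, hmO⟩, hmin⟩ :=
    (isCompact_Icc.of_isClosed_subset hcl inter_subset_left).exists_isLeast
      (by obtain ⟨s, hs, h⟩ := hne; exact ⟨s, hs, h⟩)
  have hm0 : 0 < m := lt_of_le_of_ne hm.1 (by rintro rfl; exact hmO h0)
  have hlt : ∀ s ∈ Ico 0 m, γ s ∈ K := fun s hs => by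
    have hs1 : s ∈ Icc (0 : ℝ) 1 := ⟨hs.1, hs.2.le.trans hm.2⟩
    refine hOK s hs1 (by_contra fun h => ?_)
    exact absurd (hmin ⟨hs1, h⟩) (not_le.2 hs.2)
  have hmK : γ m ∈ K := by
    rw [← hK.closure_eq]
    refine ContinuousWithinAt.mem_closure (s := Ico 0 m) ((hγ m hm).mono fun s hs =>
      ⟨hs.1, hs.2.le.trans hm.2⟩) ?_ hlt
    rw [closure_Ico hm0.ne]
    exact right_mem_Icc.2 hm0.le
  refine hmO (hstep m hm fun s hs => ?_)
  rcases hs.2.eq_or_lt with rfl | h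
  exacts [hmK, hlt s ⟨hs.1, h⟩]

end GeodesicEquation

/-! ### Taylor expansion along a set -/

section Taylor

variable {E V : Type*} [NormedAddCommGroup E] [NormedSpace ℝ E] [NormedAddCommGroup V]
  [NormedSpace ℝ V]

/-- Second order Taylor expansion, with Peano remainder, along a set that is convex near the
centre. -/
lemma taylor_two_isLittleO {F : E → V} {T : Set E} {q₀ : E} {δ₀ : ℝ} (hδ₀ : 0 < δ₀)
    (hconv : Convex ℝ (T ∩ Metric.ball q₀ δ₀)) (hT : UniqueDiffOn ℝ T) (hq : q₀ ∈ T)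
    (hqc : q₀ ∈ closure (interior T)) (hF : ContDiffWithinAt ℝ 2 F T q₀) :
    (fun q => F q - F q₀ - fderivWithin ℝ F T q₀ (q - q₀)
      - (1 / 2 : ℝ) • fderivWithin ℝ (fderivWithin ℝ F T) T q₀ (q - q₀) (q - q₀))
      =o[𝓝[T] q₀] fun q => ‖q - q₀‖ ^ 2 := by
  set D1 := fderivWithin ℝ F T
  set D2 := fderivWithin ℝ D1 T q₀
  have hD2 : HasFDerivWithinAt D1 D2 T q₀ := hasFDerivWithinAt_fderivWithin hT hq hF
  have hsymm : ∀ a b, D2 a b = D2 b a := fderivWithin_fderivWithin_symm hT hq hqc hF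
  rw [Asymptotics.isLittleO_iff]
  intro ε hε
  have h1 := (Asymptotics.isLittleO_iff.1 hD2.isLittleO) hε
  have h2 : ∀ᶠ q in 𝓝[T] q₀, ContDiffWithinAt ℝ 2 F T q := by
    have := hF.eventually (by decide)
    rwa [insert_eq_of_mem hq] at this
  obtain ⟨δ₁, hδ₁, hsub⟩ := Metric.mem_nhdsWithin_iff.1 (h1.and h2)
  have hmem : T ∩ Metric.ball q₀ (min δ₀ δ₁) ∈ 𝓝[T] q₀ :=
    inter_mem self_mem_nhdsWithin (mem_nhdsWithin_of_mem_nhds (Metric.ball_mem_nhds _ (by positivity)))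
  filter_upwards [hmem] with q hqm
  -- On the part of the set within distance `‖q - q₀‖` of `q₀` the derivative of the remainder is at
  -- most `ε ‖q - q₀‖`.
  set C := (T ∩ Metric.ball q₀ δ₀) ∩ Metric.closedBall q₀ ‖q - q₀‖ with hCdef
  have hCT : C ⊆ T := fun x hx => hx.1.1
  have hlt : ‖q - q₀‖ < min δ₀ δ₁ := by simpa [dist_eq_norm] using hqm.2
  have hqC : q ∈ C := ⟨⟨hqm.1, Metric.ball_subset_ball (min_le_left _ _) hqm.2⟩, by
    simp [dist_eq_norm]⟩
  have hq₀C : q₀ ∈ C := ⟨⟨hq, Metric.mem_ball_self hδ₀⟩, by simp⟩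
  have hderiv : ∀ x ∈ C, HasFDerivWithinAt (fun q => F q - D1 q₀ (q - q₀)
      - (1 / 2 : ℝ) • D2 (q - q₀) (q - q₀)) (D1 x - D1 q₀ - D2 (x - q₀)) C x := by
    intro x hx
    have hxs := hsub ⟨by
      have : dist x q₀ ≤ ‖q - q₀‖ := hx.2
      exact Metric.mem_ball.2 (this.trans_lt (hlt.trans_le (min_le_right _ _))), hx.1.1⟩
    have e1 : HasFDerivWithinAt F (D1 x) C x :=
      ((hxs.2.differentiableWithinAt (by norm_num)).hasFDerivWithinAt).mono hCT
    have e0 : HasFDerivWithinAt (fun q : E => q - q₀) (ContinuousLinearMap.id ℝ E) C x :=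
      (hasFDerivWithinAt_id x C).sub_const q₀
    have e2 := (D1 q₀).hasFDerivAt.comp_hasFDerivWithinAt x e0
    have e3 := ((D2.hasFDerivAt.comp_hasFDerivWithinAt x e0).clm_apply e0).const_smul (1 / 2 : ℝ)
    have e4 := (e1.sub e2).sub e3
    refine e4.congr_fderiv ?_
    ext a
    simp only [sub_apply, ContinuousLinearMap.comp_apply,
      smul_apply, add_apply,
      ContinuousLinearMap.flip_apply, ContinuousLinearMap.id_apply, Function.comp]
    rw [hsymm a (x - q₀), ← two_smul ℝ, smul_smul]
    norm_num
  have hbd : ∀ x ∈ C, ‖D1 x - D1 q₀ - D2 (x - q₀)‖ ≤ ε * ‖q - q₀‖ := by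
    intro x hx
    have hxq : dist x q₀ ≤ ‖q - q₀‖ := hx.2
    have hxs := hsub ⟨Metric.mem_ball.2 (hxq.trans_lt (hlt.trans_le (min_le_right _ _))), hx.1.1⟩
    refine hxs.1.trans ?_
    rw [← dist_eq_norm x]
    gcongr
  have := Convex.norm_image_sub_le_of_norm_hasFDerivWithin_le hderiv hbd
    (hconv.inter (convex_closedBall _ _)) hq₀C hqC
  simp only [sub_self, map_zero, smul_zero, sub_zero] at this
  rw [norm_pow, norm_norm]
  calc _ = ‖F q - D1 q₀ (q - q₀) - (1 / 2 : ℝ) • D2 (q - q₀) (q - q₀) - F q₀‖ := by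
        congr 1; abel
    _ ≤ _ := this
    _ = _ := by ring

end Taylor

/-! ### Boundary coordinates -/

section BoundaryCoordinates

variable {n : ℕ}

@[simp] lemma bdryIncl_zero_coord (z : EuclideanSpace ℝ (Fin n)) : bdryIncl z 0 = 0 := rfl

@[simp] lemma bdryProj_bdryIncl (z : EuclideanSpace ℝ (Fin n)) : bdryProj (bdryIncl z) = z := rfl

lemma bdryIncl_bdryProj {x : EuclideanSpace ℝ (Fin (n + 1))} (hx : x 0 = 0) :
    bdryIncl (bdryProj x) = x := by
  ext i
  refine Fin.cases ?_ (fun j => ?_) i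
  exacts [hx.symm, rfl]

lemma contDiff_bdryIncl {m : WithTop ℕ∞} : ContDiff ℝ m (bdryIncl (n := n)) := by
  rw [contDiff_euclidean]
  intro i
  refine Fin.cases ?_ (fun j => ?_) i
  · exact contDiff_const
  · exact contDiff_piLp_apply (𝕜 := ℝ) (p := 2) (i := j)

lemma contDiff_bdryProj {m : WithTop ℕ∞} : ContDiff ℝ m (bdryProj (n := n)) := by
  rw [contDiff_euclidean]
  exact fun i => contDiff_piLp_apply (𝕜 := ℝ) (p := 2) (i := i.succ)

variable {M : Type*} [TopologicalSpace M] [ChartedSpace (EuclideanHalfSpace (n + 1)) M]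

/-- Every chart maps boundary points, and only these, to the hyperplane `{x₀ = 0}`. -/
lemma mem_boundary_iff_extChartAt [IsManifold (𝓡∂ (n + 1)) 3 M] {p q : M}
    (hq : q ∈ (extChartAt (𝓡∂ (n + 1)) p).source) :
    q ∈ (𝓡∂ (n + 1)).boundary M ↔ extChartAt (𝓡∂ (n + 1)) p q 0 = 0 := by
  have hmem := (extChartAt (𝓡∂ (n + 1)) p).map_source hq
  rw [extChartAt_source] at hq
  have h1 : (𝓡∂ (n + 1)).IsInteriorPoint q
      ↔ extChartAt (𝓡∂ (n + 1)) p q ∈ interior (range (𝓡∂ (n + 1))) := by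
    rw [(𝓡∂ (n + 1)).isInteriorPoint_iff_of_mem_atlas (n := 3) (by norm_num)
      (chart_mem_atlas _ p) hq]
    refine ⟨fun h => OpenPartialHomeomorph.interior_extend_target_subset_interior_range _ h,
      fun h => OpenPartialHomeomorph.mem_interior_extend_target _
        ((chartAt _ p).map_source hq) h⟩
  have h2 : 0 ≤ extChartAt (𝓡∂ (n + 1)) p q 0 := by
    have := extChartAt_target_subset_range p hmem
    rwa [range_modelWithCornersEuclideanHalfSpace] at this
  rw [interior_range_modelWithCornersEuclideanHalfSpace] at h1
  rw [← (𝓡∂ (n + 1)).compl_interior, mem_compl_iff]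
  refine (not_congr (show q ∈ (𝓡∂ (n + 1)).interior M ↔ _ from h1)).trans
    ⟨fun h => le_antisymm (not_lt.1 h) h2, fun h => not_lt.2 (le_of_eq h)⟩

lemma bdryIncl_mem_range (z : EuclideanSpace ℝ (Fin n)) : bdryIncl z ∈ range (𝓡∂ (n + 1)) := by
  rw [range_modelWithCornersEuclideanHalfSpace]
  exact le_refl (0 : ℝ)

lemma isOpen_bdryTarget (p : M) : IsOpen (bdryTarget (n := n) p) := by
  rw [isOpen_iff_mem_nhds]
  intro z hz
  have h := extChartAt_target_mem_nhdsWithin_of_mem (I := 𝓡∂ (n + 1)) hz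
  have ht : Tendsto bdryIncl (𝓝 z) (𝓝[range (𝓡∂ (n + 1))] bdryIncl z) :=
    tendsto_nhdsWithin_iff.2 ⟨(contDiff_bdryIncl (m := 0)).continuous.continuousAt,
      Eventually.of_forall bdryIncl_mem_range⟩
  exact ht h

lemma bdryPoint_mem_source {p : M} {z : EuclideanSpace ℝ (Fin n)} (hz : z ∈ bdryTarget p) :
    bdryPoint p z ∈ (extChartAt (𝓡∂ (n + 1)) p).source :=
  (extChartAt (𝓡∂ (n + 1)) p).map_target hz

lemma extChartAt_bdryPoint {p : M} {z : EuclideanSpace ℝ (Fin n)} (hz : z ∈ bdryTarget p) :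
    extChartAt (𝓡∂ (n + 1)) p (bdryPoint p z) = bdryIncl z :=
  (extChartAt (𝓡∂ (n + 1)) p).right_inv hz

lemma bdryCoord_bdryPoint {p : M} {z : EuclideanSpace ℝ (Fin n)} (hz : z ∈ bdryTarget p) :
    bdryCoord p (bdryPoint p z) = z := by
  rw [bdryCoord, extChartAt_bdryPoint hz, bdryProj_bdryIncl]

lemma continuousOn_bdryPoint (p : M) : ContinuousOn (bdryPoint (n := n) p) (bdryTarget p) :=
  (continuousOn_extChartAt_symm p).comp (contDiff_bdryIncl (m := 0)).continuous.continuousOn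
    fun _ hz => hz

lemma continuousOn_bdryCoord (p : M) :
    ContinuousOn (bdryCoord (n := n) p) (extChartAt (𝓡∂ (n + 1)) p).source :=
  (contDiff_bdryProj (m := 0)).continuous.comp_continuousOn (continuousOn_extChartAt p)

variable [IsManifold (𝓡∂ (n + 1)) 3 M]

lemma bdryPoint_mem_boundary {p : M} {z : EuclideanSpace ℝ (Fin n)} (hz : z ∈ bdryTarget p) :
    bdryPoint p z ∈ (𝓡∂ (n + 1)).boundary M := by
  rw [mem_boundary_iff_extChartAt (bdryPoint_mem_source hz), extChartAt_bdryPoint hz]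
  rfl

lemma bdryIncl_bdryCoord {p q : M} (hq : q ∈ (extChartAt (𝓡∂ (n + 1)) p).source)
    (hqb : q ∈ (𝓡∂ (n + 1)).boundary M) :
    bdryIncl (bdryCoord (n := n) p q) = extChartAt (𝓡∂ (n + 1)) p q :=
  bdryIncl_bdryProj ((mem_boundary_iff_extChartAt hq).1 hqb)

lemma bdryCoord_mem_bdryTarget {p q : M} (hq : q ∈ (extChartAt (𝓡∂ (n + 1)) p).source)
    (hqb : q ∈ (𝓡∂ (n + 1)).boundary M) : bdryCoord (n := n) p q ∈ bdryTarget p := by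
  have := (extChartAt (𝓡∂ (n + 1)) p).map_source hq
  rwa [← bdryIncl_bdryCoord hq hqb] at this

lemma bdryPoint_bdryCoord {p q : M} (hq : q ∈ (extChartAt (𝓡∂ (n + 1)) p).source)
    (hqb : q ∈ (𝓡∂ (n + 1)).boundary M) :
    bdryPoint p (bdryCoord (n := n) p q) = q := by
  rw [bdryPoint, bdryIncl_bdryCoord hq hqb, (extChartAt (𝓡∂ (n + 1)) p).left_inv hq]

lemma contDiffWithinAt_extChartAt_comp {E' : Type*} [NormedAddCommGroup E'] [NormedSpace ℝ E']
    {γ : E' → M} {T : Set E'} {x : E'} {p : M}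
    (hγ : ContMDiffWithinAt 𝓘(ℝ, E') (𝓡∂ (n + 1)) 2 γ T x)
    (hp : γ x ∈ (extChartAt (𝓡∂ (n + 1)) p).source) :
    ContDiffWithinAt ℝ 2 (fun x' => extChartAt (𝓡∂ (n + 1)) p (γ x')) T x := by
  have : IsManifold (𝓡∂ (n + 1)) 2 M := IsManifold.of_le (n := 3) (by norm_num)
  rw [extChartAt_source] at hp
  exact contMDiffWithinAt_iff_contDiffWithinAt.1
    ((contMDiffWithinAt_iff_target_of_mem_source hp).1 hγ).2

end BoundaryCoordinates

/-! ### Maps into the manifold, seen in `ℝᵈ` -/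

section ChartParam

variable {n d : ℕ} {M : Type*} [TopologicalSpace M] [ChartedSpace (EuclideanHalfSpace (n + 1)) M]
  {ι : M → EuclideanSpace ℝ (Fin d)}

lemma uniqueDiffOn_halfSpace : UniqueDiffOn ℝ (range (𝓡∂ (n + 1))) := (𝓡∂ (n + 1)).uniqueDiffOn

lemma extChartAt_mem_halfSpace (p q : M) :
    extChartAt (𝓡∂ (n + 1)) p q ∈ range (𝓡∂ (n + 1)) := by
  rw [extChartAt_coe]
  exact mem_range_self _

lemma extChartAt_mem_closure_interior_halfSpace (p q : M) :
    extChartAt (𝓡∂ (n + 1)) p q ∈ closure (interior (range (𝓡∂ (n + 1)))) :=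
  (𝓡∂ (n + 1)).range_subset_closure_interior (extChartAt_mem_halfSpace p q)

lemma IsC3Embedding.contDiffWithinAt_chartParam (hι : IsC3Embedding (n := n) ι) (p : M) :
    ContDiffWithinAt ℝ 2 (chartParam (n := n) ι p) (range (𝓡∂ (n + 1)))
      (extChartAt (𝓡∂ (n + 1)) p p) := by
  have h := (contMDiffAt_iff.1 (hι.contMDiff p)).2
  exact ContDiffWithinAt.of_le h (by norm_num)

lemma IsC3Embedding.injective_fderivWithin_chartParam (hι : IsC3Embedding (n := n) ι) (p : M) :
    Function.Injective (fderivWithin ℝ (chartParam (n := n) ι p) (range (𝓡∂ (n + 1)))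
      (extChartAt (𝓡∂ (n + 1)) p p)) := by
  have h := hι.injective_mfderiv p
  have he := ((hι.contMDiff p).mdifferentiableAt (by norm_num)).mfderiv
  intro a b hab
  refine h ?_
  rw [he]
  exact hab

lemma eventuallyEq_chartParam_comp {E' : Type*} [TopologicalSpace E'] {γ : E' → M} {T : Set E'}
    {x : E'} (hγ : ContinuousWithinAt γ T x) :
    (fun x' => ι (γ x')) =ᶠ[𝓝[T] x] fun x' =>
      chartParam (n := n) ι (γ x) (extChartAt (𝓡∂ (n + 1)) (γ x) (γ x')) := by
  filter_upwards [hγ (extChartAt_source_mem_nhds (I := 𝓡∂ (n + 1)) (γ x))] with x' hx'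
  rw [chartParam, (extChartAt (𝓡∂ (n + 1)) (γ x)).left_inv hx']

variable [IsManifold (𝓡∂ (n + 1)) 3 M]
  {E' : Type*} [NormedAddCommGroup E'] [NormedSpace ℝ E'] {γ : E' → M} {T : Set E'} {x : E'}

/-- Chain rule for a map into `M`, in the chart around the image of the point of differentiation. -/
lemma IsC3Embedding.fderivWithin_comp (hι : IsC3Embedding (n := n) ι) (hT : UniqueDiffOn ℝ T)
    (hx : x ∈ T) (hγ : ContMDiffWithinAt 𝓘(ℝ, E') (𝓡∂ (n + 1)) 2 γ T x) :
    fderivWithin ℝ (fun x' => ι (γ x')) T x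
      = (fderivWithin ℝ (chartParam (n := n) ι (γ x)) (range (𝓡∂ (n + 1)))
          (extChartAt (𝓡∂ (n + 1)) (γ x) (γ x))).comp
        (fderivWithin ℝ (fun x' => extChartAt (𝓡∂ (n + 1)) (γ x) (γ x')) T x) := by
  have he := eventuallyEq_chartParam_comp (n := n) (ι := ι) hγ.continuousWithinAt
  rw [he.fderivWithin_eq (he.self_of_nhdsWithin hx)]
  exact fderivWithin_comp_of_eventually_mem
    (F := chartParam (n := n) ι (γ x)) (σ := fun x' => extChartAt (𝓡∂ (n + 1)) (γ x) (γ x')) hT hx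
    ((hι.contDiffWithinAt_chartParam (γ x)).differentiableWithinAt (by norm_num))
    ((contDiffWithinAt_extChartAt_comp hγ (mem_extChartAt_source _)).differentiableWithinAt
      (by norm_num)) (Eventually.of_forall fun _ => extChartAt_mem_halfSpace _ _)

lemma IsC3Embedding.fderivWithin_fderivWithin_comp (hι : IsC3Embedding (n := n) ι)
    (hT : UniqueDiffOn ℝ T) (hx : x ∈ T)
    (hγ : ContMDiffWithinAt 𝓘(ℝ, E') (𝓡∂ (n + 1)) 2 γ T x) (a b : E') :
    fderivWithin ℝ (fderivWithin ℝ (fun x' => ι (γ x')) T) T x a b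
      = fderivWithin ℝ (fderivWithin ℝ (chartParam (n := n) ι (γ x)) (range (𝓡∂ (n + 1))))
          (range (𝓡∂ (n + 1))) (extChartAt (𝓡∂ (n + 1)) (γ x) (γ x))
          (fderivWithin ℝ (fun x' => extChartAt (𝓡∂ (n + 1)) (γ x) (γ x')) T x a)
          (fderivWithin ℝ (fun x' => extChartAt (𝓡∂ (n + 1)) (γ x) (γ x')) T x b)
        + fderivWithin ℝ (chartParam (n := n) ι (γ x)) (range (𝓡∂ (n + 1)))
          (extChartAt (𝓡∂ (n + 1)) (γ x) (γ x))
          (fderivWithin ℝ (fderivWithin ℝ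
            (fun x' => extChartAt (𝓡∂ (n + 1)) (γ x) (γ x')) T) T x a b) := by
  have he := (eventuallyEq_chartParam_comp (n := n) (ι := ι) hγ.continuousWithinAt).fderivWithin (𝕜 := ℝ)
  rw [he.fderivWithin_eq (he.self_of_nhdsWithin hx)]
  exact Semigeodesic.fderivWithin_fderivWithin_comp
    (F := chartParam (n := n) ι (γ x)) (σ := fun x' => extChartAt (𝓡∂ (n + 1)) (γ x) (γ x'))
    uniqueDiffOn_halfSpace hT hx (hι.contDiffWithinAt_chartParam (γ x))
    (contDiffWithinAt_extChartAt_comp hγ (mem_extChartAt_source _))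
    (Eventually.of_forall fun _ => extChartAt_mem_halfSpace _ _) a b

/-- The acceleration in `ℝᵈ` of a geodesic of `M` is normal to `M`. -/
lemma IsGeodesicOn.inner_acceleration_eq_zero {γ : ℝ → M} {J : Set ℝ} {s : ℝ}
    (hγ : IsGeodesicOn (n := n) ι γ J) (hι : IsC3Embedding (n := n) ι) (hJ : UniqueDiffOn ℝ J)
    (hs : s ∈ J) (w : EuclideanSpace ℝ (Fin (n + 1))) :
    ⟪derivWithin (derivWithin (fun s' => ι (γ s')) J) J s,
      fderivWithin ℝ (chartParam (n := n) ι (γ s)) (range (𝓡∂ (n + 1)))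
        (extChartAt (𝓡∂ (n + 1)) (γ s) (γ s)) w⟫_ℝ = 0 := by
  have he := (eventuallyEq_chartParam_comp (n := n) (ι := ι) (hγ.1 s hs).continuousWithinAt)
  have he' := he.derivWithin
  rw [he'.derivWithin_eq (he'.self_of_nhdsWithin hs)]
  exact inner_derivWithin_derivWithin_eq_zero_of_covAccel
    (F := chartParam (n := n) ι (γ s)) (c := fun s' => extChartAt (𝓡∂ (n + 1)) (γ s) (γ s'))
    uniqueDiffOn_halfSpace (extChartAt_mem_closure_interior_halfSpace _ _) hJ hs
    (hι.contDiffWithinAt_chartParam (γ s))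
    (contDiffWithinAt_extChartAt_comp (hγ.1 s hs) (mem_extChartAt_source _))
    (Eventually.of_forall fun _ => extChartAt_mem_halfSpace _ _)
    (hι.injective_fderivWithin_chartParam (γ s))
    (hγ.2 (γ s) s hs (mem_extChartAt_source _)) w

end ChartParam

/-! ### The normal collar and the Gauss lemma -/

section Collar

variable {n d : ℕ} {M : Type*} [TopologicalSpace M] [ChartedSpace (EuclideanHalfSpace (n + 1)) M]

/-- The collar as a map into `ℝᵈ`, in the coordinates of `∂M` from the chart around `p`. -/
noncomputable def collarParam (ι : M → EuclideanSpace ℝ (Fin d)) (φ : M → ℝ → M) (p : M) :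
    EuclideanSpace ℝ (Fin n) × ℝ → EuclideanSpace ℝ (Fin d) :=
  fun q => ι (φ (bdryPoint (n := n) p q.1) q.2)

/-- The domain of `collarParam`. -/
def collarDom (n : ℕ) {M : Type*} [TopologicalSpace M]
    [ChartedSpace (EuclideanHalfSpace (n + 1)) M] (r : ℝ) (p : M) :
    Set (EuclideanSpace ℝ (Fin n) × ℝ) :=
  bdryTarget p ×ˢ Ico 0 r

variable {ι : M → EuclideanSpace ℝ (Fin d)} {r : ℝ} {φ : M → ℝ → M} {p : M}
  {q : EuclideanSpace ℝ (Fin n) × ℝ}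

lemma uniqueDiffOn_collarDom (r : ℝ) (p : M) : UniqueDiffOn ℝ (collarDom n r p) :=
  (isOpen_bdryTarget p).uniqueDiffOn.prod (uniqueDiffOn_Ico 0 r)

lemma mem_closure_interior_collarDom (hq : q ∈ collarDom n r p) :
    q ∈ closure (interior (collarDom n r p)) := by
  rw [collarDom, interior_prod_eq, closure_prod_eq, (isOpen_bdryTarget p).interior_eq,
    interior_Ico, closure_Ioo (hq.2.1.trans_lt hq.2.2).ne]
  exact ⟨subset_closure hq.1, Ico_subset_Icc_self hq.2⟩

lemma IsNormalCollar.contMDiffWithinAt_slice (hφ : IsNormalCollar (n := n) ι r φ) {t : ℝ}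
    (ht : t ∈ Ico 0 r) {z : EuclideanSpace ℝ (Fin n)} (hz : z ∈ bdryTarget p) :
    ContMDiffWithinAt 𝓘(ℝ, EuclideanSpace ℝ (Fin n)) (𝓡∂ (n + 1)) 2
      (fun z' => levelPoint (n := n) φ t p z') (bdryTarget p) z := by
  have hg : ContMDiffWithinAt 𝓘(ℝ, EuclideanSpace ℝ (Fin n)) 𝓘(ℝ, EuclideanSpace ℝ (Fin n) × ℝ) 2
      (fun z' : EuclideanSpace ℝ (Fin n) => (z', t)) (bdryTarget p) z :=
    contMDiffWithinAt_iff_contDiffWithinAt.2 (contDiff_id.prodMk contDiff_const).contDiffWithinAt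
  exact ContMDiffWithinAt.comp (t := bdryTarget p ×ˢ Ico 0 r) z (hφ.contMDiffOn p (z, t) ⟨hz, ht⟩) hg
    fun z' hz' => ⟨hz', ht⟩

lemma IsNormalCollar.contDiffWithinAt_collarParam (hι : IsC3Embedding (n := n) ι)
    (hφ : IsNormalCollar (n := n) ι r φ) (hq : q ∈ collarDom n r p) :
    ContDiffWithinAt ℝ 2 (collarParam (n := n) ι φ p) (collarDom n r p) q :=
  contMDiffWithinAt_iff_contDiffWithinAt.1
    (((hι.contMDiff.of_le (by norm_num)).contMDiffAt).comp_contMDiffWithinAt q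
      (hφ.contMDiffOn p q hq))

lemma IsNormalCollar.contDiffAt_levelParam (hι : IsC3Embedding (n := n) ι)
    (hφ : IsNormalCollar (n := n) ι r φ) (hq : q ∈ collarDom n r p) :
    ContDiffAt ℝ 2 (levelParam (n := n) ι φ q.2 p) q.1 :=
  (contMDiffWithinAt_iff_contDiffWithinAt.1
    (((hι.contMDiff.of_le (by norm_num)).contMDiffAt).comp_contMDiffWithinAt q.1
      (hφ.contMDiffWithinAt_slice hq.2 hq.1))).contDiffAt
    ((isOpen_bdryTarget (n := n) p).mem_nhds hq.1)

/-- Derivatives of the collar along a normal geodesic. -/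
lemma IsNormalCollar.derivWithin_collarParam [IsManifold (𝓡∂ (n + 1)) 3 M]
    (hι : IsC3Embedding (n := n) ι) (hφ : IsNormalCollar (n := n) ι r φ) (hq : q ∈ collarDom n r p) :
    derivWithin (fun s => ι (φ (bdryPoint (n := n) p q.1) s)) (Ico 0 r) q.2
      = fderivWithin ℝ (collarParam (n := n) ι φ p) (collarDom n r p) q (0, 1) ∧
    derivWithin (derivWithin (fun s => ι (φ (bdryPoint (n := n) p q.1) s)) (Ico 0 r)) (Ico 0 r) q.2
      = fderivWithin ℝ (fderivWithin ℝ (collarParam (n := n) ι φ p) (collarDom n r p))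
          (collarDom n r p) q (0, 1) (0, 1) := by
  have e : (fun s => ι (φ (bdryPoint (n := n) p q.1) s)) = fun s : ℝ => collarParam (n := n) ι φ p
      ((q.1, 0) + ContinuousLinearMap.inr ℝ (EuclideanSpace ℝ (Fin n)) ℝ s) := by
    funext s
    simp [collarParam]
  have e2 : (q.1, 0) + ContinuousLinearMap.inr ℝ (EuclideanSpace ℝ (Fin n)) ℝ q.2 = q := by
    ext <;> simp
  have hm : ∀ s ∈ Ico 0 r, (q.1, 0) + ContinuousLinearMap.inr ℝ (EuclideanSpace ℝ (Fin n)) ℝ s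
      ∈ collarDom n r p := fun s hs => by
    have e3 : (q.1, 0) + ContinuousLinearMap.inr ℝ (EuclideanSpace ℝ (Fin n)) ℝ s = (q.1, s) := by
      ext <;> simp
    rw [e3]
    exact ⟨hq.1, hs⟩
  have hF := hφ.contDiffWithinAt_collarParam hι hq
  have hc := contMDiffWithinAt_iff_contDiffWithinAt.1
    (((hι.contMDiff.of_le
      (show (2 : WithTop ℕ∞) ≤ 3 by norm_num)).contMDiffAt).comp_contMDiffWithinAt q.2 ((hφ.isGeodesicOn _ (bdryPoint_mem_boundary hq.1)).1 q.2 hq.2))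
  have h := fderivWithin_fderivWithin_comp_affine (uniqueDiffOn_collarDom r p)
    (uniqueDiffOn_Ico 0 r) hq.2 (F := collarParam (n := n) ι φ p) (by rwa [e2]) hm 1 1
  rw [e2, ← e] at h
  refine ⟨?_, ?_⟩
  · rw [← fderivWithin_derivWithin]
    simpa using h.1
  · refine (derivWithin_derivWithin_eq (uniqueDiffOn_Ico 0 r) hq.2 hc).trans ?_
    simpa [Function.comp_def] using h.2

/-- Derivatives of the parametrization of a level hypersurface. -/
lemma IsNormalCollar.fderiv_levelParam (hι : IsC3Embedding (n := n) ι)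
    (hφ : IsNormalCollar (n := n) ι r φ) (hq : q ∈ collarDom n r p)
    (a b : EuclideanSpace ℝ (Fin n)) :
    fderiv ℝ (levelParam (n := n) ι φ q.2 p) q.1 a
      = fderivWithin ℝ (collarParam (n := n) ι φ p) (collarDom n r p) q (a, 0) ∧
    fderiv ℝ (fderiv ℝ (levelParam (n := n) ι φ q.2 p)) q.1 a b
      = fderivWithin ℝ (fderivWithin ℝ (collarParam (n := n) ι φ p) (collarDom n r p))
          (collarDom n r p) q (a, 0) (b, 0) := by
  have e : levelParam (n := n) ι φ q.2 p = fun z => collarParam (n := n) ι φ p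
      ((0, q.2) + ContinuousLinearMap.inl ℝ (EuclideanSpace ℝ (Fin n)) ℝ z) := by
    funext s
    simp [collarParam, levelParam, levelPoint]
  have e2 : (0, q.2) + ContinuousLinearMap.inl ℝ (EuclideanSpace ℝ (Fin n)) ℝ q.1 = q := by
    ext <;> simp
  have hm : ∀ z ∈ bdryTarget p, (0, q.2) + ContinuousLinearMap.inl ℝ (EuclideanSpace ℝ (Fin n)) ℝ z
      ∈ collarDom n r p := fun z hz => by
    have e3 : (0, q.2) + ContinuousLinearMap.inl ℝ (EuclideanSpace ℝ (Fin n)) ℝ z = (z, q.2) := by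
      ext <;> simp
    rw [e3]
    exact ⟨hz, hq.2⟩
  have hF := hφ.contDiffWithinAt_collarParam hι hq
  have h := fderivWithin_fderivWithin_comp_affine (uniqueDiffOn_collarDom r p)
    (isOpen_bdryTarget p).uniqueDiffOn hq.1 (F := collarParam (n := n) ι φ p) (by rwa [e2]) hm a b
  rw [e2, ← e] at h
  have hU := (isOpen_bdryTarget (n := n) p).mem_nhds hq.1
  have ee : fderivWithin ℝ (levelParam (n := n) ι φ q.2 p) (bdryTarget p) =ᶠ[𝓝 q.1]
      fderiv ℝ (levelParam (n := n) ι φ q.2 p) := by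
    filter_upwards [hU] with z hz using
      fderivWithin_of_mem_nhds ((isOpen_bdryTarget (n := n) p).mem_nhds hz)
  rw [fderivWithin_of_mem_nhds hU, fderivWithin_of_mem_nhds hU, ee.fderiv_eq] at h
  simpa using h

lemma IsNormalCollar.injective_fderiv_levelParam (hι : IsC3Embedding (n := n) ι)
    (hφ : IsNormalCollar (n := n) ι r φ) (hq : q ∈ collarDom n r p) :
    Function.Injective (fderiv ℝ (levelParam (n := n) ι φ q.2 p) q.1) := by
  intro a b hab
  rw [(hφ.fderiv_levelParam hι hq a a).1, (hφ.fderiv_levelParam hι hq b b).1] at hab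
  exact congrArg Prod.fst (hφ.injective_deriv p q hq hab)

/-- The tangent space of `M` at a point of the collar contains the image of the derivative of the
collar. -/
lemma IsNormalCollar.exists_fderivWithin_eq [IsManifold (𝓡∂ (n + 1)) 3 M]
    (hι : IsC3Embedding (n := n) ι) (hφ : IsNormalCollar (n := n) ι r φ) (hq : q ∈ collarDom n r p)
    (w : EuclideanSpace ℝ (Fin n) × ℝ) :
    ∃ w', fderivWithin ℝ (collarParam (n := n) ι φ p) (collarDom n r p) q w
      = fderivWithin ℝ (chartParam (n := n) ι (φ (bdryPoint (n := n) p q.1) q.2))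
        (range (𝓡∂ (n + 1))) (extChartAt (𝓡∂ (n + 1)) (φ (bdryPoint (n := n) p q.1) q.2)
          (φ (bdryPoint (n := n) p q.1) q.2)) w' :=
  ⟨_, congrArg (fun L => L w) (hι.fderivWithin_comp (uniqueDiffOn_collarDom r p) hq
    (γ := fun q => φ (bdryPoint (n := n) p q.1) q.2) (hφ.contMDiffOn p q hq))⟩

/-- The acceleration of a normal geodesic is normal to `M`. -/
lemma IsNormalCollar.inner_acceleration_eq_zero [IsManifold (𝓡∂ (n + 1)) 3 M]
    (hι : IsC3Embedding (n := n) ι) (hφ : IsNormalCollar (n := n) ι r φ) (hq : q ∈ collarDom n r p)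
    (w : EuclideanSpace ℝ (Fin n) × ℝ) :
    ⟪fderivWithin ℝ (fderivWithin ℝ (collarParam (n := n) ι φ p) (collarDom n r p))
          (collarDom n r p) q (0, 1) (0, 1),
      fderivWithin ℝ (collarParam (n := n) ι φ p) (collarDom n r p) q w⟫_ℝ = 0 := by
  obtain ⟨w', hw'⟩ := hφ.exists_fderivWithin_eq hι hq w
  rw [hw', ← (hφ.derivWithin_collarParam hι hq).2]
  exact (hφ.isGeodesicOn _ (bdryPoint_mem_boundary hq.1)).inner_acceleration_eq_zero hι
    (uniqueDiffOn_Ico 0 r) hq.2 w'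

/-- An inner product of coordinate vector fields with vanishing normal derivative is constant along
the normal geodesics. -/
lemma IsNormalCollar.inner_eq_inner_start (hι : IsC3Embedding (n := n) ι)
    (hφ : IsNormalCollar (n := n) ι r φ) {a b : EuclideanSpace ℝ (Fin n) × ℝ}
    (h : ∀ q ∈ collarDom n r p,
      ⟪fderivWithin ℝ (fderivWithin ℝ (collarParam (n := n) ι φ p) (collarDom n r p))
          (collarDom n r p) q (0, 1) a,
        fderivWithin ℝ (collarParam (n := n) ι φ p) (collarDom n r p) q b⟫_ℝ
      + ⟪fderivWithin ℝ (collarParam (n := n) ι φ p) (collarDom n r p) q a,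
        fderivWithin ℝ (fderivWithin ℝ (collarParam (n := n) ι φ p) (collarDom n r p))
          (collarDom n r p) q (0, 1) b⟫_ℝ = 0) (hq : q ∈ collarDom n r p) :
    ⟪fderivWithin ℝ (collarParam (n := n) ι φ p) (collarDom n r p) q a,
      fderivWithin ℝ (collarParam (n := n) ι φ p) (collarDom n r p) q b⟫_ℝ
    = ⟪fderivWithin ℝ (collarParam (n := n) ι φ p) (collarDom n r p) (q.1, 0) a,
      fderivWithin ℝ (collarParam (n := n) ι φ p) (collarDom n r p) (q.1, 0) b⟫_ℝ := by
  set f : EuclideanSpace ℝ (Fin n) × ℝ → ℝ := fun q =>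
    ⟪fderivWithin ℝ (collarParam (n := n) ι φ p) (collarDom n r p) q a,
      fderivWithin ℝ (collarParam (n := n) ι φ p) (collarDom n r p) q b⟫_ℝ
  have hd : ∀ s ∈ Ico 0 r, HasDerivWithinAt (fun s => f (q.1, s)) 0 (Ico 0 r) s := by
    intro s hs
    have hqs : (q.1, s) ∈ collarDom n r p := ⟨hq.1, hs⟩
    obtain ⟨L, hL, hLa⟩ := hasFDerivWithinAt_inner_fderivWithin (uniqueDiffOn_collarDom r p) hqs
      (hφ.contDiffWithinAt_collarParam hι hqs) a b
    have hc : HasDerivWithinAt (fun s : ℝ => (q.1, s)) ((0 : EuclideanSpace ℝ (Fin n)), (1 : ℝ))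
        (Ico 0 r) s := (hasDerivWithinAt_const s _ q.1).prodMk (hasDerivWithinAt_id s _)
    have := HasFDerivWithinAt.comp_hasDerivWithinAt s hL hc
      (fun s' hs' => (⟨hq.1, hs'⟩ : (q.1, s') ∈ collarDom n r p))
    rwa [hLa, h _ hqs] at this
  have h0 : (0 : ℝ) ∈ Ico 0 r := ⟨le_rfl, hφ.pos⟩
  have := Convex.norm_image_sub_le_of_norm_hasDerivWithin_le (C := 0) hd (by simp)
    (convex_Ico 0 r) h0 hq.2
  rw [zero_mul, norm_le_zero_iff, sub_eq_zero] at this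
  exact this

/-- Along the boundary, `∂_s` is the unit normal. -/
lemma IsNormalCollar.inner_start_eq [IsManifold (𝓡∂ (n + 1)) 3 M]
    (hι : IsC3Embedding (n := n) ι) (hφ : IsNormalCollar (n := n) ι r φ)
    {z : EuclideanSpace ℝ (Fin n)} (hz : z ∈ bdryTarget p)
    (a : EuclideanSpace ℝ (Fin n)) :
    ⟪fderivWithin ℝ (collarParam (n := n) ι φ p) (collarDom n r p) (z, 0) (0, 1),
      fderivWithin ℝ (collarParam (n := n) ι φ p) (collarDom n r p) (z, 0) (0, 1)⟫_ℝ = 1 ∧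
    ⟪fderivWithin ℝ (collarParam (n := n) ι φ p) (collarDom n r p) (z, 0) (0, 1),
      fderivWithin ℝ (collarParam (n := n) ι φ p) (collarDom n r p) (z, 0) (a, 0)⟫_ℝ = 0 := by
  have h0 : (0 : ℝ) ∈ Ico 0 r := ⟨le_rfl, hφ.pos⟩
  have hq : (z, (0 : ℝ)) ∈ collarDom n r p := ⟨hz, h0⟩
  have hb := bdryPoint_mem_boundary hz
  set y' := bdryPoint (n := n) p z with hy'
  have hstart : φ y' 0 = y' := hφ.start y' hb
  have hs := hι.fderivWithin_comp (uniqueDiffOn_Ico 0 r) h0 (γ := φ y')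
    ((hφ.isGeodesicOn _ hb).1 0 h0)
  have hs1 := congrArg (fun L => L 1) hs
  simp only [fderivWithin_derivWithin, ContinuousLinearMap.comp_apply, hstart] at hs1
  have hN := (hφ.derivWithin_collarParam hι hq).1
  have hl := hι.fderivWithin_comp (isOpen_bdryTarget p).uniqueDiffOn hz
    (hφ.contMDiffWithinAt_slice h0 hz)
  have hy0 : levelPoint φ 0 p z = y' := hstart
  have hla := congrArg (fun L => L a) hl
  simp only [ContinuousLinearMap.comp_apply, hy0] at hla
  have hT := (hφ.fderiv_levelParam hι hq a a).1
  rw [← fderivWithin_of_mem_nhds ((isOpen_bdryTarget (n := n) p).mem_nhds hz)] at hT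
  obtain ⟨v1, v2, -⟩ := hφ.velocity y' hb
  have hN' := hN.symm.trans hs1
  have hT' := hT.symm.trans hla
  refine ⟨?_, ?_⟩
  · rw [hN']
    exact v1
  · rw [hN', hT']
    refine v2 _ ?_
    -- The slice `s = 0` lies in the boundary, hence in the hyperplane `{x₀ = 0}` of the chart.
    set σ : EuclideanSpace ℝ (Fin n) → EuclideanSpace ℝ (Fin (n + 1)) :=
      fun z' => extChartAt (𝓡∂ (n + 1)) y' (levelPoint φ 0 p z') with hσ
    have hcm := hφ.contMDiffWithinAt_slice h0 hz
    have hσd : DifferentiableWithinAt ℝ σ (bdryTarget p) z :=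
      (contDiffWithinAt_extChartAt_comp hcm
        (by rw [hy0]; exact mem_extChartAt_source _)).differentiableWithinAt (by norm_num)
    have hsrc : ∀ᶠ z' in 𝓝[bdryTarget p] z,
        levelPoint (n := n) φ 0 p z' ∈ (extChartAt (𝓡∂ (n + 1)) y').source :=
      hcm.continuousWithinAt (by rw [hy0]; exact extChartAt_source_mem_nhds y')
    have hz0 : (fun z' => σ z' 0) =ᶠ[𝓝[bdryTarget p] z] fun _ => 0 := by
      filter_upwards [hsrc, self_mem_nhdsWithin] with z' h1 h2
      refine (mem_boundary_iff_extChartAt h1).1 ?_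
      rw [levelPoint, hφ.start _ (bdryPoint_mem_boundary h2)]
      exact bdryPoint_mem_boundary h2
    have hcomp : HasFDerivWithinAt (fun z' => σ z' 0)
        ((EuclideanSpace.proj (0 : Fin (n + 1)) : EuclideanSpace ℝ (Fin (n + 1)) →L[ℝ] ℝ).comp
          (fderivWithin ℝ σ (bdryTarget p) z)) (bdryTarget p) z :=
      (EuclideanSpace.proj (0 : Fin (n + 1)) :
        EuclideanSpace ℝ (Fin (n + 1)) →L[ℝ] ℝ).hasFDerivAt.comp_hasFDerivWithinAt z
        hσd.hasFDerivWithinAt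
    have hzero := ((hasFDerivWithinAt_const (𝕜 := ℝ) (0 : ℝ) z (bdryTarget p)).congr_of_eventuallyEq hz0
      (hz0.self_of_nhdsWithin hz))
    have := ((isOpen_bdryTarget (n := n) p).uniqueDiffOn z hz).eq hcomp hzero
    exact congrArg (fun L => L a) this

/-- The normal geodesics have unit speed. -/
lemma IsNormalCollar.inner_normal_normal [IsManifold (𝓡∂ (n + 1)) 3 M]
    (hι : IsC3Embedding (n := n) ι) (hφ : IsNormalCollar (n := n) ι r φ) (hq : q ∈ collarDom n r p) :
    ⟪fderivWithin ℝ (collarParam (n := n) ι φ p) (collarDom n r p) q (0, 1),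
      fderivWithin ℝ (collarParam (n := n) ι φ p) (collarDom n r p) q (0, 1)⟫_ℝ = 1 := by
  rw [hφ.inner_eq_inner_start hι (fun q hq => ?_) hq, (hφ.inner_start_eq hι hq.1 0).1]
  rw [real_inner_comm _ (fderivWithin ℝ (collarParam ι φ p) _ q (0, 1)),
    hφ.inner_acceleration_eq_zero hι hq, add_zero]

lemma IsNormalCollar.inner_of_inner_eq_const (hι : IsC3Embedding (n := n) ι)
    (hφ : IsNormalCollar (n := n) ι r φ) {a b : EuclideanSpace ℝ (Fin n) × ℝ} {C : ℝ}
    (h : ∀ q ∈ collarDom n r p,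
      ⟪fderivWithin ℝ (collarParam (n := n) ι φ p) (collarDom n r p) q a,
        fderivWithin ℝ (collarParam (n := n) ι φ p) (collarDom n r p) q b⟫_ℝ = C)
    (hq : q ∈ collarDom n r p) (w : EuclideanSpace ℝ (Fin n) × ℝ) :
    ⟪fderivWithin ℝ (fderivWithin ℝ (collarParam (n := n) ι φ p) (collarDom n r p))
          (collarDom n r p) q w a,
        fderivWithin ℝ (collarParam (n := n) ι φ p) (collarDom n r p) q b⟫_ℝ
      + ⟪fderivWithin ℝ (collarParam (n := n) ι φ p) (collarDom n r p) q a,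
        fderivWithin ℝ (fderivWithin ℝ (collarParam (n := n) ι φ p) (collarDom n r p))
          (collarDom n r p) q w b⟫_ℝ = 0 := by
  obtain ⟨L, hL, hLa⟩ := hasFDerivWithinAt_inner_fderivWithin (uniqueDiffOn_collarDom r p) hq
      (hφ.contDiffWithinAt_collarParam hι hq) a b
  rw [← hLa, (uniqueDiffOn_collarDom r p q hq).eq hL
    ((hasFDerivWithinAt_const C q (collarDom n r p)).congr h (h q hq))]
  rfl

lemma IsNormalCollar.snd_fderivWithin_symm (hι : IsC3Embedding (n := n) ι)
    (hφ : IsNormalCollar (n := n) ι r φ) (hq : q ∈ collarDom n r p)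
    (a b : EuclideanSpace ℝ (Fin n) × ℝ) :
    fderivWithin ℝ (fderivWithin ℝ (collarParam (n := n) ι φ p) (collarDom n r p))
        (collarDom n r p) q a b
      = fderivWithin ℝ (fderivWithin ℝ (collarParam (n := n) ι φ p) (collarDom n r p))
        (collarDom n r p) q b a :=
  fderivWithin_fderivWithin_symm (uniqueDiffOn_collarDom r p) hq
    (mem_closure_interior_collarDom hq) (hφ.contDiffWithinAt_collarParam hι hq) a b

/-- As `∂_s` has constant length, it is orthogonal to its derivatives. -/
lemma IsNormalCollar.inner_normal_deriv_normal [IsManifold (𝓡∂ (n + 1)) 3 M]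
    (hι : IsC3Embedding (n := n) ι) (hφ : IsNormalCollar (n := n) ι r φ) (hq : q ∈ collarDom n r p)
    (w : EuclideanSpace ℝ (Fin n) × ℝ) :
    ⟪fderivWithin ℝ (collarParam (n := n) ι φ p) (collarDom n r p) q (0, 1),
        fderivWithin ℝ (fderivWithin ℝ (collarParam (n := n) ι φ p) (collarDom n r p))
          (collarDom n r p) q w (0, 1)⟫_ℝ = 0 := by
  have h := hφ.inner_of_inner_eq_const hι (fun q hq => hφ.inner_normal_normal hι hq) hq w
  rw [real_inner_comm (fderivWithin ℝ (collarParam ι φ p) _ q (0, 1))] at h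
  linarith

/-- The Gauss lemma: the normal geodesics are orthogonal to the level hypersurfaces. -/
lemma IsNormalCollar.inner_normal_tangent [IsManifold (𝓡∂ (n + 1)) 3 M]
    (hι : IsC3Embedding (n := n) ι) (hφ : IsNormalCollar (n := n) ι r φ) (hq : q ∈ collarDom n r p)
    (a : EuclideanSpace ℝ (Fin n)) :
    ⟪fderivWithin ℝ (collarParam (n := n) ι φ p) (collarDom n r p) q (0, 1),
      fderivWithin ℝ (collarParam (n := n) ι φ p) (collarDom n r p) q (a, 0)⟫_ℝ = 0 := by
  rw [hφ.inner_eq_inner_start hι (fun q hq => ?_) hq, (hφ.inner_start_eq hι hq.1 a).2]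
  rw [hφ.inner_acceleration_eq_zero hι hq, hφ.snd_fderivWithin_symm hι hq, hφ.inner_normal_deriv_normal hι hq,
    add_zero]

/-- Differentiating the Gauss lemma along the level hypersurface: `⟨A, Φ_zs a⟩ = -⟨N, Φ_zz(a, a)⟩`. -/
lemma IsNormalCollar.inner_tangent_deriv_normal [IsManifold (𝓡∂ (n + 1)) 3 M]
    (hι : IsC3Embedding (n := n) ι) (hφ : IsNormalCollar (n := n) ι r φ) (hq : q ∈ collarDom n r p)
    (a : EuclideanSpace ℝ (Fin n)) :
    ⟪fderivWithin ℝ (collarParam (n := n) ι φ p) (collarDom n r p) q (a, 0),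
        fderivWithin ℝ (fderivWithin ℝ (collarParam (n := n) ι φ p) (collarDom n r p))
          (collarDom n r p) q (a, 0) (0, 1)⟫_ℝ
    = -⟪fderivWithin ℝ (collarParam (n := n) ι φ p) (collarDom n r p) q (0, 1),
        fderivWithin ℝ (fderivWithin ℝ (collarParam (n := n) ι φ p) (collarDom n r p))
          (collarDom n r p) q (a, 0) (a, 0)⟫_ℝ := by
  have h := hφ.inner_of_inner_eq_const hι (fun q hq => hφ.inner_normal_tangent hι hq a) hq (a, 0)
  rw [real_inner_comm] at h
  linarith

end Collar

/-! ### Normal coordinates of a level hypersurface -/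

section NormalCoordinates

variable {n d : ℕ} {M : Type*} [TopologicalSpace M] [ChartedSpace (EuclideanHalfSpace (n + 1)) M]
  {ι : M → EuclideanSpace ℝ (Fin d)} {r t : ℝ} {φ : M → ℝ → M} {y : M}

/-- The map `v ↦ ∑ vⁱ eᵢ` as a continuous linear map. -/
noncomputable def frameCLM (e : Fin n → EuclideanSpace ℝ (Fin n)) :
    EuclideanSpace ℝ (Fin n) →L[ℝ] EuclideanSpace ℝ (Fin n) :=
  ∑ i, (EuclideanSpace.proj i : EuclideanSpace ℝ (Fin n) →L[ℝ] ℝ).smulRight (e i)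

lemma frameCLM_apply (e : Fin n → EuclideanSpace ℝ (Fin n)) (v : EuclideanSpace ℝ (Fin n)) :
    frameCLM e v = frameVec e v := by
  simp [frameCLM, frameVec]

/-- The Christoffel symbols, contracted with two vectors, as a bilinear map. -/
noncomputable def christoffelForm {k : ℕ} (F : EuclideanSpace ℝ (Fin k) → EuclideanSpace ℝ (Fin d))
    (S : Set (EuclideanSpace ℝ (Fin k))) (z : EuclideanSpace ℝ (Fin k)) :
    EuclideanSpace ℝ (Fin k) →L[ℝ] EuclideanSpace ℝ (Fin k) →L[ℝ] EuclideanSpace ℝ (Fin k) :=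
  (ContinuousLinearMap.compL ℝ _ _ _ (raise F S z)).comp
    (fderivWithin ℝ (fderivWithin ℝ F S) S z)

lemma christoffelForm_apply {k : ℕ} {F : EuclideanSpace ℝ (Fin k) → EuclideanSpace ℝ (Fin d)}
    {z : EuclideanSpace ℝ (Fin k)} (hF : ContDiffAt ℝ 2 F z) (a b : EuclideanSpace ℝ (Fin k)) :
    christoffelForm F univ z a b = christoffel F univ z a b := by
  rw [christoffel_eq_raise uniqueDiffOn_univ (mem_univ z) (by simp) hF]
  rfl

/-- Continuity, in norm, of the composition of a family of linear maps with a family of bilinear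
maps. -/
lemma eventually_norm_compL_comp_sub_lt {X E V G : Type*} [TopologicalSpace X]
    [NormedAddCommGroup E] [NormedSpace ℝ E] [NormedAddCommGroup V] [NormedSpace ℝ V]
    [NormedAddCommGroup G] [NormedSpace ℝ G] {R : X → V →L[ℝ] G} {D : X → E →L[ℝ] E →L[ℝ] V} {x : X}
    (hR : ContinuousAt R x) (hD : ContinuousAt D x) {ε : ℝ} (hε : 0 < ε) :
    ∀ᶠ x' in 𝓝 x, ‖(ContinuousLinearMap.compL ℝ E V G (R x')).comp (D x')
      - (ContinuousLinearMap.compL ℝ E V G (R x)).comp (D x)‖ < ε := by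
  have h : ContinuousAt (fun x' => (ContinuousLinearMap.compL ℝ E V G (R x')).comp (D x')) x :=
    ((ContinuousLinearMap.compL ℝ E V G).continuous.continuousAt.comp hR).clm_comp hD
  exact ((tendsto_iff_norm_sub_tendsto_zero (E := E →L[ℝ] E →L[ℝ] G)).1
    h.tendsto).eventually_lt_const hε

lemma eventually_norm_christoffelForm_sub_lt {k : ℕ}
    {F : EuclideanSpace ℝ (Fin k) → EuclideanSpace ℝ (Fin d)}
    {z : EuclideanSpace ℝ (Fin k)} (hF : ContDiffAt ℝ 2 F z)
    (hinj : Function.Injective (fderiv ℝ F z)) {ε : ℝ} (hε : 0 < ε) :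
    ∀ᶠ z' in 𝓝 z, ‖christoffelForm F univ z' - christoffelForm F univ z‖ < ε := by
  have h1 : ContDiffWithinAt ℝ 1 (fderivWithin ℝ F univ) univ z :=
    ContDiffWithinAt.fderivWithin_right (n := 2) hF uniqueDiffOn_univ (by norm_num) (mem_univ z)
  have h2 : ContDiffWithinAt ℝ 0 (fderivWithin ℝ (fderivWithin ℝ F univ) univ) univ z :=
    h1.fderivWithin_right uniqueDiffOn_univ (by norm_num) (mem_univ z)
  have h3 := continuousWithinAt_raise h1.continuousWithinAt
    (by rwa [fderivWithin_univ])
  exact eventually_norm_compL_comp_sub_lt ((continuousWithinAt_univ _ _).1 h3)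
    ((continuousWithinAt_univ _ _).1 h2.continuousWithinAt) hε

/-- Second order expansion of the endpoint of one geodesic of a level hypersurface. On a closed ball
around the centre the Christoffel symbols are within `ε` of their value at the centre; a geodesic
with small starting speed cannot leave that ball in unit time. -/
lemma IsSemigeodesic.norm_expansion_le [IsManifold (𝓡∂ (n + 1)) 3 M]
    (hι : IsC3Embedding (n := n) ι) (hφ : IsNormalCollar (n := n) ι r φ) (ht : t ∈ Ico 0 r)
    {ρ h : ℝ} {e : Fin n → EuclideanSpace ℝ (Fin n)}
    {β : EuclideanSpace ℝ (Fin n) → M} (hβ : IsSemigeodesic (n := n) ι r φ t y ρ h e β)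
    {B : EuclideanSpace ℝ (Fin n) →
      EuclideanSpace ℝ (Fin n) →L[ℝ] EuclideanSpace ℝ (Fin n) →L[ℝ] EuclideanSpace ℝ (Fin n)}
    (hB : B = christoffelForm (levelParam (n := n) ι φ t y) univ)
    {z₀ : EuclideanSpace ℝ (Fin n)} (hz₀ : bdryCoord (n := n) y y = z₀) {K δ ε α : ℝ} (hδ : 0 < δ)
    (hδsub : ∀ z ∈ Metric.closedBall z₀ δ,
      z ∈ bdryTarget (n := n) y ∧ ‖B z - B z₀‖ ≤ ε ∧ ‖B z‖ ≤ K)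
    {v : EuclideanSpace ℝ (Fin n)} (hv : ‖v‖ < ρ) (hα : 0 < α) (hvα : ‖frameVec e v‖ ≤ α)
    (hKα : 4 * K * α < 1) (hδα : 2 * α < δ) :
    (β v ∈ (extChartAt (𝓡∂ (n + 1)) y).source ∧ β v ∈ (𝓡∂ (n + 1)).boundary M) ∧
      ‖bdryCoord (n := n) y (β v) - (z₀ + frameVec e v
        - (1 / 2 : ℝ) • B z₀ (frameVec e v) (frameVec e v))‖
        ≤ (4 * ε + 12 * K ^ 2 * α) * α ^ 2 := by
  have : T2Space M := hι.isEmbedding.t2Space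
  obtain ⟨hbd, hsm, hgeo⟩ := hβ.isLevelGeodesicOn v hv
  have hvel := hβ.velocity v hv
  set γ : ℝ → M := fun s => β (s • v)
  set c : ℝ → EuclideanSpace ℝ (Fin n) := fun s => bdryCoord (n := n) y (γ s) with hc
  set p : ℝ → EuclideanSpace ℝ (Fin n) := derivWithin c (Icc 0 1) with hp
  have hJ : UniqueDiffOn ℝ (Icc (0 : ℝ) 1) := uniqueDiffOn_Icc one_pos
  have hγ0 : γ 0 = y := by simp only [γ, zero_smul, hβ.center]
  have hc0 : c 0 = z₀ := by simp only [hc, hγ0, hz₀]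
  have hp0 : p 0 = frameVec e v := hvel
  set Kset : Set M := bdryPoint (n := n) y '' Metric.closedBall z₀ δ with hKset
  have hKcl : IsClosed Kset := ((isCompact_closedBall z₀ δ).image_of_continuousOn
    ((continuousOn_bdryPoint y).mono fun z hz => (hδsub z hz).1)).isClosed
  have hKmem : ∀ x ∈ Kset, x ∈ (extChartAt (𝓡∂ (n + 1)) y).source ∧
      bdryCoord (n := n) y x ∈ Metric.closedBall z₀ δ := by
    rintro _ ⟨z, hz, rfl⟩
    have hzU := (hδsub z hz).1
    exact ⟨bdryPoint_mem_source hzU, by rwa [bdryCoord_bdryPoint hzU]⟩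
  set O : Set M := (extChartAt (𝓡∂ (n + 1)) y).source ∩ bdryCoord (n := n) y ⁻¹' Metric.ball z₀ δ
  have hO : IsOpen O := (continuousOn_bdryCoord y).isOpen_inter_preimage
    (isOpen_extChartAt_source y) Metric.isOpen_ball
  -- The differential equation, as long as the geodesic stays in the compact set.
  have hode : ∀ s ∈ Icc (0 : ℝ) 1, γ s ∈ Kset →
      HasDerivWithinAt c (p s) (Icc 0 1) s ∧
      HasDerivWithinAt p (-(B (c s) (p s) (p s))) (Icc 0 1) s ∧
      ‖B (c s) - B z₀‖ ≤ ε ∧ ‖B (c s)‖ ≤ K := by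
    intro s hs hsK
    obtain ⟨h1, h2⟩ := hKmem _ hsK
    have h3 := hδsub _ h2
    have hcC : ContDiffWithinAt ℝ 2 c (Icc 0 1) s :=
      (contDiff_bdryProj (n := n)).contDiffAt.comp_contDiffWithinAt s
        (contDiffWithinAt_extChartAt_comp (hsm s hs) h1)
    have hFC : ContDiffAt ℝ 2 (levelParam (n := n) ι φ t y) (c s) :=
      hφ.contDiffAt_levelParam (q := (c s, t)) hι ⟨h3.1, ht⟩
    have hacc : derivWithin p (Icc 0 1) s = -(B (c s) (p s) (p s)) := by
      rw [hB, christoffelForm_apply hFC]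
      exact eq_neg_of_add_eq_zero_left (hgeo y s hs h1)
    refine ⟨(hcC.differentiableWithinAt (by norm_num)).hasDerivWithinAt, ?_, h3.2⟩
    rw [← hacc]
    exact hasDerivWithinAt_derivWithin hJ hs hcC
  have hpα : ‖p 0‖ ≤ α := by rw [hp0]; exact hvα
  have hOK : ∀ s ∈ Icc (0 : ℝ) 1, γ s ∈ O → γ s ∈ Kset := fun s hs hsO =>
    ⟨c s, Metric.ball_subset_closedBall hsO.2, bdryPoint_bdryCoord hsO.1 (hbd s hs)⟩
  have hstay : ∀ s ∈ Icc (0 : ℝ) 1, γ s ∈ O := by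
    refine mem_of_continuousOn_of_bootstrap hsm.continuousOn hKcl hO ?_ hOK fun τ hτ hτK => ?_
    · rw [hγ0]
      exact ⟨mem_extChartAt_source y, by rw [mem_preimage, hz₀]; exact Metric.mem_ball_self hδ⟩
    · have hsub : Icc 0 τ ⊆ Icc (0 : ℝ) 1 := Icc_subset_Icc_right hτ.2
      have hτmem : τ ∈ Icc 0 τ := right_mem_Icc.2 hτ.1
      have := (norm_le_of_quadratic_ode hτ.2 hα hKα
        (fun s hs => (hode s (hsub hs) (hτK s hs)).1.mono hsub)
        (fun s hs => (hode s (hsub hs) (hτK s hs)).2.1.mono hsub)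
        (fun s hs => (hode s (hsub hs) (hτK s hs)).2.2.2) hpα τ hτmem).2
      refine ⟨(hKmem _ (hτK τ hτmem)).1, Metric.mem_ball.2 ?_⟩
      rw [hc0] at this
      rw [dist_eq_norm]
      exact this.trans_lt hδα
  have hone : (1 : ℝ) ∈ Icc (0 : ℝ) 1 := right_mem_Icc.2 zero_le_one
  have hγ1 : γ 1 = β v := by simp only [γ, one_smul]
  have hK' : ∀ s ∈ Icc (0 : ℝ) 1, γ s ∈ Kset := fun s hs => hOK s hs (hstay s hs)
  have hfin := norm_expansion_le_of_quadratic_ode (B₀ := B z₀) (ε := ε) hα hKα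
    (fun s hs => (hode s hs (hK' s hs)).1) (fun s hs => (hode s hs (hK' s hs)).2.1)
    (fun s hs => (hode s hs (hK' s hs)).2.2.2) hpα
    (hδsub z₀ (Metric.mem_closedBall_self hδ.le)).2.2
    (fun s hs => (hode s hs (hK' s hs)).2.2.1)
  refine ⟨⟨hγ1 ▸ (hstay 1 hone).1, hγ1 ▸ hbd 1 hone⟩, ?_⟩
  rw [hc0, hp0] at hfin
  simp only [hc, hγ1] at hfin
  exact hfin

/-- Second order expansion of normal coordinates of a level hypersurface at their centre. -/
lemma IsSemigeodesic.eventually_expansion [IsManifold (𝓡∂ (n + 1)) 3 M]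
    (hι : IsC3Embedding (n := n) ι) (hφ : IsNormalCollar (n := n) ι r φ) (ht : t ∈ Ico 0 r)
    (hy : y ∈ (𝓡∂ (n + 1)).boundary M) {ρ h : ℝ} {e : Fin n → EuclideanSpace ℝ (Fin n)}
    {β : EuclideanSpace ℝ (Fin n) → M} (hβ : IsSemigeodesic (n := n) ι r φ t y ρ h e β)
    {ε : ℝ} (hε : 0 < ε) :
    ∀ᶠ v in 𝓝 (0 : EuclideanSpace ℝ (Fin n)),
      (β v ∈ (extChartAt (𝓡∂ (n + 1)) y).source ∧ β v ∈ (𝓡∂ (n + 1)).boundary M) ∧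
      ‖bdryCoord (n := n) y (β v) - (bdryCoord (n := n) y y + frameVec e v
        - (1 / 2 : ℝ) • christoffelForm (levelParam (n := n) ι φ t y) univ (bdryCoord (n := n) y y)
          (frameVec e v) (frameVec e v))‖ ≤ ε * ‖v‖ ^ 2 := by
  obtain ⟨z₀, hz₀⟩ : ∃ z₀, bdryCoord (n := n) y y = z₀ := ⟨_, rfl⟩
  obtain ⟨B, hB⟩ : ∃ B, B = christoffelForm (levelParam (n := n) ι φ t y) univ := ⟨_, rfl⟩
  have hysrc : y ∈ (extChartAt (𝓡∂ (n + 1)) y).source := mem_extChartAt_source y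
  have hzU : z₀ ∈ bdryTarget (n := n) y := by
    rw [← hz₀]
    exact bdryCoord_mem_bdryTarget hysrc hy
  have hBc : ∀ ε > 0, ∀ᶠ z in 𝓝 z₀, ‖B z - B z₀‖ < ε := fun ε hε => by
    rw [hB]
    exact eventually_norm_christoffelForm_sub_lt
      (hφ.contDiffAt_levelParam (q := (z₀, t)) hι ⟨hzU, ht⟩)
      (hφ.injective_fderiv_levelParam (q := (z₀, t)) hι ⟨hzU, ht⟩) hε
  rw [hz₀, ← hB]
  set C := ‖frameCLM e‖ + 1 with hC
  have hC0 : 0 < C := by positivity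
  have hframe : ∀ v, ‖frameVec e v‖ ≤ C * ‖v‖ := fun v => by
    rw [← frameCLM_apply]
    refine ((frameCLM e).le_opNorm v).trans ?_
    gcongr
    linarith
  set K := ‖B z₀‖ + 1 with hK
  have hK0 : 0 < K := by positivity
  -- Half of `ε` absorbs the variation of `B`, the other half the higher order terms.
  set ε₁ := min (ε / (8 * C ^ 2)) 1 with hε₁
  have hε₁0 : 0 < ε₁ := by positivity
  have hUn : ∀ᶠ z in 𝓝 z₀, z ∈ bdryTarget (n := n) y :=
    (isOpen_bdryTarget y).eventually_mem hzU
  obtain ⟨δ, hδ, hδsub⟩ := Metric.nhds_basis_closedBall.eventually_iff.1 (hUn.and (hBc ε₁ hε₁0))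
  have hδsub' : ∀ z ∈ Metric.closedBall z₀ δ,
      z ∈ bdryTarget (n := n) y ∧ ‖B z - B z₀‖ ≤ ε₁ ∧ ‖B z‖ ≤ K := fun z hz => by
    obtain ⟨h1, h2⟩ := hδsub hz
    refine ⟨h1, h2.le, ?_⟩
    have h3 := norm_le_norm_add_norm_sub' (B z) (B z₀)
    have h5 : ε₁ ≤ 1 := min_le_right _ _
    linarith
  have hsmall : ∀ c b : ℝ, 0 < b →
      ∀ᶠ v in 𝓝 (0 : EuclideanSpace ℝ (Fin n)), c * ‖v‖ < b := fun c b hb => by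
    have hcont : Tendsto (fun v : EuclideanSpace ℝ (Fin n) => c * ‖v‖) (𝓝 0) (𝓝 0) := by
      have hc : Continuous fun v : EuclideanSpace ℝ (Fin n) => c * ‖v‖ := by fun_prop
      simpa only [norm_zero, mul_zero] using hc.tendsto 0
    exact hcont.eventually_lt_const hb
  filter_upwards [hsmall 1 ρ hβ.radius_pos, hsmall (4 * K * C) 1 one_pos, hsmall (2 * C) δ hδ,
    hsmall (12 * K ^ 2 * C * C ^ 2) (ε / 2) (by positivity)] with v hv1 hv2 hv3 hv4
  rw [one_mul] at hv1
  rcases eq_or_ne v 0 with rfl | hv0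
  · have hf0 : frameVec e 0 = 0 := by rw [← frameCLM_apply, map_zero]
    rw [hβ.center, hf0]
    exact ⟨⟨hysrc, hy⟩, by simp [hz₀]⟩
  obtain ⟨h1, h2⟩ := hβ.norm_expansion_le hι hφ ht hB hz₀ hδ hδsub' hv1
    (mul_pos hC0 (norm_pos_iff.2 hv0)) (hframe v) (by rw [← mul_assoc]; exact hv2)
    (by rw [← mul_assoc]; exact hv3)
  refine ⟨h1, h2.trans ?_⟩
  have h6 : ε₁ * (8 * C ^ 2) ≤ ε := by
    rw [← le_div_iff₀ (by positivity)]
    exact min_le_left _ _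
  have h7 : (4 * ε₁ + 12 * K ^ 2 * (C * ‖v‖)) * (C * ‖v‖) ^ 2
      = (ε₁ * (8 * C ^ 2) / 2 + 12 * K ^ 2 * C * C ^ 2 * ‖v‖) * ‖v‖ ^ 2 := by ring
  rw [h7]
  gcongr
  linarith

end NormalCoordinates

/-! ### The second fundamental form of a level hypersurface -/

section SecondFundamentalForm

variable {n d : ℕ} {M : Type*} [TopologicalSpace M] [ChartedSpace (EuclideanHalfSpace (n + 1)) M]
  [IsManifold (𝓡∂ (n + 1)) 3 M]
  {ι : M → EuclideanSpace ℝ (Fin d)} {r t : ℝ} {φ : M → ℝ → M} {y : M}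

lemma center_mem_collarDom (ht : t ∈ Ico 0 r) (hy : y ∈ (𝓡∂ (n + 1)).boundary M) :
    (bdryCoord (n := n) y y, t) ∈ collarDom n r y :=
  ⟨bdryCoord_mem_bdryTarget (mem_extChartAt_source y) hy, ht⟩

lemma bdryPoint_center (hy : y ∈ (𝓡∂ (n + 1)).boundary M) :
    bdryPoint y (bdryCoord (n := n) y y) = y :=
  bdryPoint_bdryCoord (mem_extChartAt_source y) hy

lemma IsNormalCollar.normalVec_eq (hι : IsC3Embedding (n := n) ι)
    (hφ : IsNormalCollar (n := n) ι r φ) (ht : t ∈ Ico 0 r)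
    (hy : y ∈ (𝓡∂ (n + 1)).boundary M) :
    normalVec ι r φ t y = fderivWithin ℝ (collarParam (n := n) ι φ y) (collarDom n r y)
      (bdryCoord (n := n) y y, t) (0, 1) := by
  rw [← (hφ.derivWithin_collarParam hι (center_mem_collarDom ht hy)).1]
  simp only [bdryPoint_center hy]
  rfl

/-- The Gauss formula: paired with the unit normal, the second fundamental form of a level
hypersurface in `M` is the second derivative of its parametrization in `ℝᵈ`. -/
lemma IsNormalCollar.inner_secondFundForm (hι : IsC3Embedding (n := n) ι)
    (hφ : IsNormalCollar (n := n) ι r φ) (ht : t ∈ Ico 0 r)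
    (hy : y ∈ (𝓡∂ (n + 1)).boundary M) (a : EuclideanSpace ℝ (Fin n)) :
    ⟪secondFundForm ι φ t y a a, normalVec ι r φ t y⟫_ℝ
      = ⟪fderivWithin ℝ (collarParam (n := n) ι φ y) (collarDom n r y)
          (bdryCoord (n := n) y y, t) (0, 1),
        fderivWithin ℝ (fderivWithin ℝ (collarParam (n := n) ι φ y) (collarDom n r y))
          (collarDom n r y) (bdryCoord (n := n) y y, t) (a, 0) (a, 0)⟫_ℝ := by
  have hq := center_mem_collarDom (n := n) (r := r) ht hy
  set z₀ := bdryCoord (n := n) y y with hz₀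
  have hN := hφ.normalVec_eq hι ht hy
  obtain ⟨w', hw'⟩ := hφ.exists_fderivWithin_eq hι hq (0, 1)
  simp only [hz₀, bdryPoint_center hy] at hw'
  have hlp : levelPoint (n := n) φ t y z₀ = φ y t := by rw [levelPoint, hz₀, bdryPoint_center hy]
  -- The normal vector is orthogonal to the level hypersurface, so the projection may be dropped.
  have hNT : normalVec ι r φ t y ∈ (LinearMap.range
      (fderiv ℝ (levelParam (n := n) ι φ t y) z₀).toLinearMap)ᗮ := by
    rw [Submodule.mem_orthogonal]
    rintro _ ⟨b, rfl⟩
    have h1 := (hφ.fderiv_levelParam hι hq b b).1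
    rw [hN, real_inner_comm, ← hφ.inner_normal_tangent hι hq b, ← h1]
    rfl
  have hproj : ⟪secondFundForm ι φ t y a a, normalVec ι r φ t y⟫_ℝ
      = ⟪fderivWithin ℝ (chartParam (n := n) ι (φ y t)) (range (𝓡∂ (n + 1)))
          (extChartAt (𝓡∂ (n + 1)) (φ y t) (φ y t)) (levelNabla ι φ t y a a),
          normalVec ι r φ t y⟫_ℝ := by
    rw [secondFundForm, Submodule.inner_starProjection_left_eq_right,
      Submodule.starProjection_eq_self_iff.2 hNT]
  have hcm : ContMDiffWithinAt 𝓘(ℝ, EuclideanSpace ℝ (Fin n)) (𝓡∂ (n + 1)) 2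
      (fun z' => levelPoint (n := n) φ t y z') univ z₀ :=
    (hφ.contMDiffWithinAt_slice ht hq.1).contMDiffAt ((isOpen_bdryTarget y).mem_nhds hq.1)
  have hσ := contDiffWithinAt_extChartAt_comp (p := φ y t) hcm
    (by rw [hlp]; exact mem_extChartAt_source _)
  have h2 := hι.fderivWithin_fderivWithin_comp uniqueDiffOn_univ (mem_univ z₀) hcm a a
  simp only [fderivWithin_univ, hlp] at h2
  have h3 := (hφ.fderiv_levelParam hι hq a a).2
  have h4 : fderiv ℝ (fderiv ℝ (fun z' => ι (levelPoint (n := n) φ t y z'))) z₀ a a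
      = fderiv ℝ (fderiv ℝ (levelParam (n := n) ι φ t y)) z₀ a a := rfl
  set σ : EuclideanSpace ℝ (Fin n) → EuclideanSpace ℝ (Fin (n + 1)) :=
    fun z => extChartAt (𝓡∂ (n + 1)) (φ y t) (levelPoint (n := n) φ t y z) with hσdef
  have h5 : fderiv ℝ (fun z => fderiv ℝ σ z a) z₀ a = fderiv ℝ (fderiv ℝ σ) z₀ a a := by
    have hd : HasFDerivAt (fderiv ℝ σ) (fderiv ℝ (fderiv ℝ σ) z₀) z₀ := by
      have := hasFDerivWithinAt_fderivWithin uniqueDiffOn_univ (mem_univ z₀) hσ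
      simpa only [fderivWithin_univ, hasFDerivWithinAt_univ] using this
    rw [(hd.clm_apply (hasFDerivAt_const a z₀)).fderiv]
    simp
  have h6 : levelNabla ι φ t y a a = fderiv ℝ (fderiv ℝ σ) z₀ a a
      + christoffel (chartParam (n := n) ι (φ y t)) (range (𝓡∂ (n + 1)))
        (extChartAt (𝓡∂ (n + 1)) (φ y t) (φ y t)) (fderiv ℝ σ z₀ a) (fderiv ℝ σ z₀ a) := by
    rw [← h5, ← show σ z₀ = extChartAt (𝓡∂ (n + 1)) (φ y t) (φ y t) by simp only [hσdef, hlp]]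
    rfl
  have h7 := inner_sub_christoffel_eq_zero uniqueDiffOn_halfSpace
    (extChartAt_mem_halfSpace (φ y t) (φ y t))
    (extChartAt_mem_closure_interior_halfSpace (φ y t) (φ y t))
    (hι.contDiffWithinAt_chartParam (φ y t)) (hι.injective_fderivWithin_chartParam (φ y t))
    (fderiv ℝ σ z₀ a) (fderiv ℝ σ z₀ a) w'
  rw [inner_sub_left, sub_eq_zero] at h7
  rw [hproj, ← h3, ← h4, h2, h6, hN, real_inner_comm, hw', map_add, inner_add_right, inner_add_right,
    real_inner_comm (fderivWithin ℝ (chartParam (n := n) ι (φ y t)) _ _ (christoffel _ _ _ _ _)),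
    ← h7, add_comm, real_inner_comm]

end SecondFundamentalForm

/-! ### Asymptotic expansions -/

section Asymptotics

open Asymptotics

variable {E E' V : Type*} [NormedAddCommGroup E] [NormedSpace ℝ E] [NormedAddCommGroup E']

lemma isBigO_clm_apply₂ [NormedAddCommGroup V] [NormedSpace ℝ V] {α : Type*} {l : Filter α}
    (L : E →L[ℝ] E →L[ℝ] V) {x y : α → E} {f g : α → ℝ} (hx : x =O[l] f) (hy : y =O[l] g) :
    (fun u => L (x u) (y u)) =O[l] fun u => f u * g u := by
  refine (IsBigO.of_bound ‖L‖ (Eventually.of_forall fun u => ?_)).trans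
    (hx.norm_left.mul hy.norm_left)
  refine (L.le_opNorm₂ _ _).trans (le_of_eq ?_)
  simp [mul_assoc]

lemma isLittleO_norm_pow_norm_pow {l : Filter E'} (hl : l ≤ 𝓝 0) {i j : ℕ} (h : j < i) :
    (fun u : E' => ‖u‖ ^ i) =o[l] fun u => ‖u‖ ^ j :=
  ((isLittleO_pow_pow h).comp_tendsto (tendsto_norm_zero)).mono hl

/-- Second order expansion of `F` along a map that is itself given by a second order expansion
`q₀ + ℓ + k`, with `ℓ` of first and `k` of second order. -/
lemma isLittleO_comp_expansion [NormedAddCommGroup V] [NormedSpace ℝ V] {F : E → V} {T : Set E}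
    {q₀ : E} {D1 : E →L[ℝ] V} {D2 : E →L[ℝ] E →L[ℝ] V}
    (hF : (fun q => F q - F q₀ - D1 (q - q₀) - (1 / 2 : ℝ) • D2 (q - q₀) (q - q₀))
      =o[𝓝[T] q₀] fun q => ‖q - q₀‖ ^ 2)
    {l : Filter E'} (hl : l ≤ 𝓝 0) {q ℓ k : E' → E} (hq : ∀ᶠ u in l, q u ∈ T)
    (hℓ : ℓ =O[l] fun u => ‖u‖) (hk : k =O[l] fun u => ‖u‖ ^ 2)
    (hω : (fun u => q u - (q₀ + ℓ u + k u)) =o[l] fun u => ‖u‖ ^ 2) :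
    (fun u => F (q u) - F q₀ - D1 (ℓ u) - (D1 (k u) + (1 / 2 : ℝ) • D2 (ℓ u) (ℓ u)))
      =o[l] fun u => ‖u‖ ^ 2 := by
  have h21 : (fun u : E' => ‖u‖ ^ 2) =O[l] fun u => ‖u‖ := by
    simpa using (isLittleO_norm_pow_norm_pow (E' := E') hl one_lt_two).isBigO
  have hm : (fun u => k u + (q u - (q₀ + ℓ u + k u))) =O[l] fun u => ‖u‖ ^ 2 := hk.add hω.isBigO
  have hd : (fun u => q u - q₀) =O[l] fun u => ‖u‖ := by
    refine (hℓ.add (hm.trans h21)).congr_left fun u => ?_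
    abel
  have hnorm : Tendsto (fun u : E' => ‖u‖) l (𝓝 0) := tendsto_norm_zero.mono_left hl
  have htend : Tendsto q l (𝓝[T] q₀) := by
    refine tendsto_nhdsWithin_iff.2 ⟨?_, hq⟩
    exact tendsto_sub_nhds_zero_iff.1 (hd.trans_tendsto hnorm)
  have h1 := (hF.comp_tendsto htend).trans_isBigO
    (show _ =O[l] fun u => ‖u‖ ^ 2 from hd.norm_left.pow 2)
  have h2 : (fun u => D1 (q u - (q₀ + ℓ u + k u))) =o[l] fun u => ‖u‖ ^ 2 :=
    (D1.isBigO_comp _ l).trans_isLittleO hω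
  have h3 : (fun u => D2 (q u - q₀) (k u + (q u - (q₀ + ℓ u + k u)))) =o[l] fun u => ‖u‖ ^ 2 :=
    (isBigO_clm_apply₂ D2 hd hm).trans_isLittleO
      ((isLittleO_norm_pow_norm_pow hl (show 2 < 3 by norm_num)).congr_left fun u => by ring)
  have h4 : (fun u => D2 (k u + (q u - (q₀ + ℓ u + k u))) (ℓ u)) =o[l] fun u => ‖u‖ ^ 2 :=
    (isBigO_clm_apply₂ D2 hm hℓ).trans_isLittleO
      ((isLittleO_norm_pow_norm_pow hl (show 2 < 3 by norm_num)).congr_left fun u => by ring)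
  refine (((h1.add h2).add (h3.const_smul_left (1 / 2 : ℝ))).add
    (h4.const_smul_left (1 / 2 : ℝ))).congr_left fun u => ?_
  have e1 : k u + (q u - (q₀ + ℓ u + k u)) = q u - q₀ - ℓ u := by abel
  have e2 : q u - (q₀ + ℓ u + k u) = q u - q₀ - ℓ u - k u := by abel
  simp only [Function.comp, e1, Pi.smul_apply]
  rw [e2]
  simp only [map_sub, sub_apply, smul_sub]
  abel

/-- A second order expansion `P + Q` of a vector determines its squared norm to third order. -/
lemma isLittleO_norm_sq_expansion [NormedAddCommGroup V] [InnerProductSpace ℝ V] {l : Filter E'}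
    (hl : l ≤ 𝓝 0) {g P Q : E' → V} (hP : P =O[l] fun u => ‖u‖)
    (hQ : Q =O[l] fun u => ‖u‖ ^ 2) (hg : (fun u => g u - P u - Q u) =o[l] fun u => ‖u‖ ^ 2) :
    (fun u => ‖g u‖ ^ 2 - ‖P u‖ ^ 2 - 2 * ⟪P u, Q u⟫_ℝ) =o[l] fun u => ‖u‖ ^ 3 := by
  have h1 : (fun u => ⟪P u, g u - P u - Q u⟫_ℝ) =o[l] fun u => ‖u‖ ^ 3 := by
    refine (IsBigO.of_bound 1 (Eventually.of_forall fun u => ?_)).trans_isLittleO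
      ((hP.norm_left.mul_isLittleO hg.norm_left).congr_right (fun u => by ring))
    rw [one_mul, norm_mul, norm_norm, norm_norm]
    exact norm_inner_le_norm _ _
  have h2 : (fun u => ‖Q u + (g u - P u - Q u)‖ ^ 2) =o[l] fun u => ‖u‖ ^ 3 :=
    ((hQ.add hg.isBigO).norm_left.pow 2).trans_isLittleO
      ((isLittleO_norm_pow_norm_pow hl (show 3 < 4 by norm_num)).congr_left fun u => by ring)
  refine ((h1.const_mul_left 2).add h2).congr_left fun u => ?_
  have e : g u = P u + (Q u + (g u - P u - Q u)) := by abel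
  have e' : ‖g u‖ ^ 2 = ‖P u‖ ^ 2 + 2 * ⟪P u, Q u + (g u - P u - Q u)⟫_ℝ
      + ‖Q u + (g u - P u - Q u)‖ ^ 2 := by
    conv_lhs => rw [e]
    exact norm_add_sq_real _ _
  rw [e', inner_add_right]
  ring

end Asymptotics

/-! ### The distance in semigeodesic coordinates -/

section Distance

open Asymptotics

variable {n d : ℕ} {M : Type*} [TopologicalSpace M] [ChartedSpace (EuclideanHalfSpace (n + 1)) M]
  {ι : M → EuclideanSpace ℝ (Fin d)} {r t : ℝ} {φ : M → ℝ → M} {y : M}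
  {ρ h : ℝ} {e : Fin n → EuclideanSpace ℝ (Fin n)} {β : EuclideanSpace ℝ (Fin n) → M}

lemma norm_sq_eq_tang_height (u : EuclideanSpace ℝ (Fin (n + 1))) :
    ‖u‖ ^ 2 = ‖tang u‖ ^ 2 + height u ^ 2 := by
  simp [EuclideanSpace.norm_sq_eq, Fin.sum_univ_castSucc, tang, height]

lemma norm_tang_le (u : EuclideanSpace ℝ (Fin (n + 1))) : ‖tang u‖ ≤ ‖u‖ := by
  refine le_of_sq_le_sq ?_ (norm_nonneg _)
  rw [norm_sq_eq_tang_height u]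
  nlinarith [sq_nonneg (height u)]

lemma abs_height_le (u : EuclideanSpace ℝ (Fin (n + 1))) : |height u| ≤ ‖u‖ := by
  refine le_of_sq_le_sq ?_ (norm_nonneg _)
  rw [norm_sq_eq_tang_height u, sq_abs]
  nlinarith [sq_nonneg ‖tang u‖]

lemma tang_smul (c : ℝ) (u : EuclideanSpace ℝ (Fin (n + 1))) : tang (c • u) = c • tang u := rfl

lemma height_smul (c : ℝ) (u : EuclideanSpace ℝ (Fin (n + 1))) : height (c • u) = c * height u := rfl

lemma tendsto_tang : Tendsto (tang (n := n)) (𝓝 0) (𝓝 0) :=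
  squeeze_zero_norm norm_tang_le tendsto_norm_zero

lemma tendsto_height : Tendsto (height (n := n)) (𝓝 0) (𝓝 0) :=
  squeeze_zero_norm (fun u => abs_height_le u) tendsto_norm_zero

lemma norm_fderiv_frameVec {F : EuclideanSpace ℝ (Fin n) → EuclideanSpace ℝ (Fin d)}
    {z : EuclideanSpace ℝ (Fin n)}
    (he : ∀ i j, metric F univ z (e i) (e j) = if i = j then 1 else 0)
    (v : EuclideanSpace ℝ (Fin n)) : ‖fderiv ℝ F z (frameVec e v)‖ ^ 2 = ‖v‖ ^ 2 := by
  have hon : Orthonormal ℝ fun i => fderiv ℝ F z (e i) := by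
    rw [orthonormal_iff_ite]
    intro i j
    simpa only [metric, fderivWithin_univ] using he i j
  rw [frameVec, map_sum, ← real_inner_self_eq_norm_sq]
  simp only [map_smul]
  rw [hon.inner_sum, EuclideanSpace.norm_sq_eq]
  simp [sq]

variable [IsManifold (𝓡∂ (n + 1)) 3 M]

lemma IsNormalCollar.cubicTerm_eq (hι : IsC3Embedding (n := n) ι)
    (hφ : IsNormalCollar (n := n) ι r φ) (ht : t ∈ Ico 0 r)
    (hy : y ∈ (𝓡∂ (n + 1)).boundary M) (u : EuclideanSpace ℝ (Fin (n + 1))) :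
    cubicTerm ι r φ t y e u = height u *
      ⟪fderivWithin ℝ (collarParam (n := n) ι φ y) (collarDom n r y)
          (bdryCoord (n := n) y y, t) (0, 1),
        fderivWithin ℝ (fderivWithin ℝ (collarParam (n := n) ι φ y) (collarDom n r y))
          (collarDom n r y) (bdryCoord (n := n) y y, t) (frameVec e (tang u), 0)
          (frameVec e (tang u), 0)⟫_ℝ := by
  rw [cubicTerm, inner_smul_right, hφ.inner_secondFundForm hι ht hy]

lemma IsNormalCollar.cubicTerm_smul (hι : IsC3Embedding (n := n) ι)
    (hφ : IsNormalCollar (n := n) ι r φ) (ht : t ∈ Ico 0 r)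
    (hy : y ∈ (𝓡∂ (n + 1)).boundary M) (c : ℝ) (u : EuclideanSpace ℝ (Fin (n + 1))) :
    cubicTerm ι r φ t y e (c • u) = c ^ 3 * cubicTerm ι r φ t y e u := by
  have hs : ((frameVec e (tang (c • u)), 0) : EuclideanSpace ℝ (Fin n) × ℝ)
      = c • (frameVec e (tang u), 0) := by
    rw [tang_smul, ← frameCLM_apply, map_smul, frameCLM_apply]
    ext <;> simp
  rw [hφ.cubicTerm_eq hι ht hy, hφ.cubicTerm_eq hι ht hy, hs, height_smul]
  simp only [map_smul, smul_apply, inner_smul_right]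
  ring

/-- The third order term of the squared distance. With `X = ⟨N, Φ_zz(a, a)⟩`, the summand `Φ_zz(a, a)`
contributes `h X` and the mixed derivative `2 h Φ_zs a` contributes `-2 h X`. -/
lemma IsNormalCollar.two_mul_inner_eq_neg_cubicTerm (hι : IsC3Embedding (n := n) ι)
    (hφ : IsNormalCollar (n := n) ι r φ) (ht : t ∈ Ico 0 r)
    (hy : y ∈ (𝓡∂ (n + 1)).boundary M)
    {D1 : EuclideanSpace ℝ (Fin n) × ℝ →L[ℝ] EuclideanSpace ℝ (Fin d)}
    {D2 : EuclideanSpace ℝ (Fin n) × ℝ →L[ℝ] EuclideanSpace ℝ (Fin n) × ℝ →L[ℝ]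
      EuclideanSpace ℝ (Fin d)}
    (hD1 : fderivWithin ℝ (collarParam (n := n) ι φ y) (collarDom n r y)
      (bdryCoord (n := n) y y, t) = D1)
    (hD2 : fderivWithin ℝ (fderivWithin ℝ (collarParam (n := n) ι φ y) (collarDom n r y))
      (collarDom n r y) (bdryCoord (n := n) y y, t) = D2)
    (u : EuclideanSpace ℝ (Fin (n + 1))) {a : EuclideanSpace ℝ (Fin n)}
    (ha : a = frameVec e (tang u)) :
    2 * ⟪D1 (a, height u), D1 (-((1 / 2 : ℝ) • christoffelForm (levelParam (n := n) ι φ t y) univ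
        (bdryCoord (n := n) y y) a a), 0)
      + (1 / 2 : ℝ) • D2 (a, height u) (a, height u)⟫_ℝ = -cubicTerm ι r φ t y e u := by
  have hq := center_mem_collarDom (n := n) (r := r) ht hy
  have hC := hφ.contDiffAt_levelParam hι hq
  rw [hφ.cubicTerm_eq hι ht hy, ← ha, christoffelForm_apply hC]
  -- Subtracting the Christoffel term leaves a vector normal to the level hypersurface.
  have hG : ⟪D1 (a, 0), D2 (a, 0) (a, 0)
      - D1 (christoffel (levelParam (n := n) ι φ t y) univ (bdryCoord (n := n) y y) a a, 0)⟫_ℝ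
      = 0 := by
    have h1 := inner_sub_christoffel_eq_zero uniqueDiffOn_univ (mem_univ (bdryCoord (n := n) y y))
      (by simp) hC.contDiffWithinAt
      (by rw [fderivWithin_univ]; exact hφ.injective_fderiv_levelParam hι hq) a a a
    simp only [fderivWithin_univ] at h1
    rw [(hφ.fderiv_levelParam hι hq a a).1, (hφ.fderiv_levelParam hι hq a a).2,
      (hφ.fderiv_levelParam hι hq _ a).1, hD1, hD2] at h1
    rw [real_inner_comm, h1]
  have h1 := hφ.inner_normal_tangent hι hq
    (christoffel (levelParam (n := n) ι φ t y) univ (bdryCoord (n := n) y y) a a)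
  have h2 := hφ.inner_normal_deriv_normal hι hq (a, 0)
  have h3 := hφ.inner_tangent_deriv_normal hι hq a
  have h4 := hφ.inner_acceleration_eq_zero hι hq (a, 0)
  have h5 := hφ.inner_acceleration_eq_zero hι hq (0, 1)
  have hs : D2 (0, 1) (a, 0) = D2 (a, 0) (0, 1) := hD2 ▸ hφ.snd_fderivWithin_symm hι hq (0, 1) (a, 0)
  rw [hD1] at h1
  rw [hD1, hD2] at h2 h3 h4 h5
  rw [real_inner_comm] at h4 h5
  set Γ := christoffel (levelParam (n := n) ι φ t y) univ (bdryCoord (n := n) y y) a a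
  have e1 : ((a, height u) : EuclideanSpace ℝ (Fin n) × ℝ) = (a, 0) + height u • (0, 1) := by
    ext <;> simp
  have e2 : ((-((1 / 2 : ℝ) • Γ), 0) : EuclideanSpace ℝ (Fin n) × ℝ) = (-(1 / 2 : ℝ)) • (Γ, 0) := by
    ext <;> simp
  rw [e1, e2, hD1, hD2]
  rw [inner_sub_right] at hG
  simp only [map_add, map_smul, add_apply, smul_apply, inner_add_left, inner_add_right,
    inner_smul_left, inner_smul_right, hs, h1, h2, h3, h4, h5, RCLike.conj_to_real]
  linear_combination hG

/-- Third order expansion of the squared distance in semigeodesic coordinates. -/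
lemma IsSemigeodesic.isLittleO_norm_sq_sub (hι : IsC3Embedding (n := n) ι)
    (hφ : IsNormalCollar (n := n) ι r φ) (ht : t ∈ Ico 0 r)
    (hy : y ∈ (𝓡∂ (n + 1)).boundary M) (hβ : IsSemigeodesic (n := n) ι r φ t y ρ h e β) :
    (fun u => ‖ι (semigeodesicPoint φ t β u) - ι (φ y t)‖ ^ 2 - ‖u‖ ^ 2
        + cubicTerm ι r φ t y e u)
      =o[𝓝[cylinder n r t ρ h] 0] fun u => ‖u‖ ^ 3 := by
  have hq := center_mem_collarDom (n := n) (r := r) ht hy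
  obtain ⟨z₀, hz₀⟩ : ∃ z₀, bdryCoord (n := n) y y = z₀ := ⟨_, rfl⟩
  obtain ⟨D1, hD1⟩ : ∃ D1, fderivWithin ℝ (collarParam (n := n) ι φ y) (collarDom n r y)
      (bdryCoord (n := n) y y, t) = D1 := ⟨_, rfl⟩
  obtain ⟨D2, hD2⟩ : ∃ D2, fderivWithin ℝ
      (fderivWithin ℝ (collarParam (n := n) ι φ y) (collarDom n r y))
      (collarDom n r y) (bdryCoord (n := n) y y, t) = D2 := ⟨_, rfl⟩
  obtain ⟨B, hB⟩ : ∃ B, B = christoffelForm (levelParam (n := n) ι φ t y) univ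
    (bdryCoord (n := n) y y) := ⟨_, rfl⟩
  set l : Filter (EuclideanSpace ℝ (Fin (n + 1))) := 𝓝[cylinder n r t ρ h] 0
  have hl : l ≤ 𝓝 0 := nhdsWithin_le_nhds
  have htang : Tendsto (tang (n := n)) l (𝓝 0) := tendsto_tang.mono_left hl
  -- Taylor expansion of the collar, on a neighbourhood where its domain is convex.
  obtain ⟨δ, hδ, hδsub⟩ := Metric.isOpen_iff.1 (isOpen_bdryTarget (n := n) y) _ hq.1
  have hconv : Convex ℝ (collarDom n r y ∩ Metric.ball (bdryCoord (n := n) y y, t) δ) := by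
    rw [collarDom, ← ball_prod_same, prod_inter_prod, inter_eq_self_of_subset_right hδsub]
    exact (convex_ball _ _).prod ((convex_Ico _ _).inter (convex_ball _ _))
  have hT := taylor_two_isLittleO hδ hconv (uniqueDiffOn_collarDom r y) hq
    (mem_closure_interior_collarDom hq) (hφ.contDiffWithinAt_collarParam hι hq)
  rw [hD1, hD2] at hT
  set q : EuclideanSpace ℝ (Fin (n + 1)) → EuclideanSpace ℝ (Fin n) × ℝ :=
    fun u => (bdryCoord (n := n) y (β (tang u)), t + height u) with hqdef
  set ℓ : EuclideanSpace ℝ (Fin (n + 1)) → EuclideanSpace ℝ (Fin n) × ℝ :=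
    fun u => (frameVec e (tang u), height u) with hℓdef
  set k : EuclideanSpace ℝ (Fin (n + 1)) → EuclideanSpace ℝ (Fin n) × ℝ :=
    fun u => (-((1 / 2 : ℝ) • B (frameVec e (tang u)) (frameVec e (tang u))), 0) with hkdef
  have hbase := htang.eventually (hβ.eventually_expansion hι hφ ht hy one_pos)
  have hqmem : ∀ᶠ u in l, q u ∈ collarDom n r y := by
    filter_upwards [hbase, self_mem_nhdsWithin] with u h1 h2
    exact ⟨bdryCoord_mem_bdryTarget h1.1.1 h1.1.2, h2.2.2⟩
  have hfr : (fun u => frameVec e (tang u)) =O[l] fun u => ‖u‖ := by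
    refine IsBigO.of_bound ‖frameCLM e‖ (Eventually.of_forall fun u => ?_)
    rw [← frameCLM_apply, norm_norm]
    exact ((frameCLM e).le_opNorm _).trans (by gcongr; exact norm_tang_le u)
  have hhe : (fun u => height u) =O[l] fun u => ‖u‖ :=
    IsBigO.of_bound 1 (Eventually.of_forall fun u => by
      rw [one_mul, norm_norm]; exact abs_height_le u)
  have hℓ : ℓ =O[l] fun u => ‖u‖ := hfr.prod_left hhe
  have hk : k =O[l] fun u => ‖u‖ ^ 2 := by
    refine IsBigO.prod_left ?_ (isBigO_zero _ _)
    refine (((isBigO_clm_apply₂ B hfr hfr).const_smul_left (1 / 2 : ℝ)).neg_left).congr_right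
      fun u => (sq _).symm
  have hω : (fun u => q u - ((bdryCoord (n := n) y y, t) + ℓ u + k u)) =o[l] fun u => ‖u‖ ^ 2 := by
    rw [isLittleO_iff]
    intro ε hε
    filter_upwards [htang.eventually (hβ.eventually_expansion hι hφ ht hy hε)] with u hu
    rw [← hB] at hu
    have e1 : q u - ((bdryCoord (n := n) y y, t) + ℓ u + k u)
        = (bdryCoord (n := n) y (β (tang u)) - (bdryCoord (n := n) y y + frameVec e (tang u)
          - (1 / 2 : ℝ) • B (frameVec e (tang u)) (frameVec e (tang u))), 0) := by
      simp only [hqdef, hℓdef, hkdef, Prod.mk_add_mk, Prod.mk_sub_mk, add_zero, sub_self,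
        ← sub_eq_add_neg]
    rw [e1, Prod.norm_mk, norm_zero, max_eq_left (norm_nonneg _), norm_pow, norm_norm]
    refine hu.2.trans ?_
    gcongr
    exact norm_tang_le u
  have hexp := isLittleO_comp_expansion hT hl hqmem hℓ hk hω
  have hP : (fun u => D1 (ℓ u)) =O[l] fun u => ‖u‖ := (D1.isBigO_comp _ l).trans hℓ
  have hQ : (fun u => D1 (k u) + (1 / 2 : ℝ) • D2 (ℓ u) (ℓ u)) =O[l] fun u => ‖u‖ ^ 2 :=
    ((D1.isBigO_comp _ l).trans hk).add
      (((isBigO_clm_apply₂ D2 hℓ hℓ).const_smul_left (1 / 2 : ℝ)).congr_right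
        fun u => (sq _).symm)
  have hfin := isLittleO_norm_sq_expansion hl hP hQ hexp
  refine hfin.congr' ?_ EventuallyEq.rfl
  filter_upwards [hbase] with u hu
  have e1 : collarParam (n := n) ι φ y (q u) = ι (semigeodesicPoint φ t β u) := by
    simp only [collarParam, hqdef, semigeodesicPoint, bdryPoint_bdryCoord hu.1.1 hu.1.2]
  have e2 : collarParam (n := n) ι φ y (bdryCoord (n := n) y y, t) = ι (φ y t) := by
    simp only [collarParam, bdryPoint_center hy]
  have e3 := hφ.two_mul_inner_eq_neg_cubicTerm (e := e) hι ht hy hD1 hD2 u rfl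
  rw [← hB] at e3
  -- The first order term is an isometry: the frame and the unit normal are orthonormal.
  have e4 : ‖D1 (ℓ u)‖ ^ 2 = ‖u‖ ^ 2 := by
    have h1 : D1 (ℓ u) = D1 (frameVec e (tang u), 0) + height u • D1 (0, 1) := by
      rw [← map_smul, ← map_add]
      congr 1
      ext <;> simp [hℓdef]
    have h2 := hφ.inner_normal_tangent hι hq (frameVec e (tang u))
    have h3 := hφ.inner_normal_normal hι hq
    have h4 := norm_fderiv_frameVec hβ.orthonormal (tang u)
    rw [(hφ.fderiv_levelParam hι hq _ 0).1, hD1] at h4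
    rw [hD1] at h2 h3
    rw [real_inner_self_eq_norm_sq] at h3
    rw [h1, norm_add_sq_real, inner_smul_right, real_inner_comm, h2, h4, norm_smul, mul_pow, h3,
      norm_sq_eq_tang_height u, Real.norm_eq_abs, sq_abs]
    ring
  rw [e1, e2, e4, e3]
  ring

end Distance

end Semigeodesic

theorem mainTheorem4 {n d : ℕ} {M : Type*} [TopologicalSpace M] [CompactSpace M]
    [ChartedSpace (EuclideanHalfSpace (n + 1)) M] [IsManifold (𝓡∂ (n + 1)) 3 M]
    (ι : M → EuclideanSpace ℝ (Fin d)) (hι : Semigeodesic.IsC3Embedding (n := n) ι)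
    (r : ℝ) (φ : M → ℝ → M) (hφ : Semigeodesic.IsNormalCollar (n := n) ι r φ)
    (t : ℝ) (ht : t ∈ Set.Ico 0 r) (y : M) (hy : y ∈ (𝓡∂ (n + 1)).boundary M)
    (ρ h : ℝ) (e : Fin n → EuclideanSpace ℝ (Fin n)) (β : EuclideanSpace ℝ (Fin n) → M)
    (hβ : Semigeodesic.IsSemigeodesic (n := n) ι r φ t y ρ h e β) :
    Filter.Tendsto
      (fun u : EuclideanSpace ℝ (Fin (n + 1)) =>
        Semigeodesic.distQuotient (n := n) ι φ t y β u
          - (-Semigeodesic.cubicTerm (n := n) ι r φ t y e (‖u‖⁻¹ • u)))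
      (𝓝[Semigeodesic.cylinder n r t ρ h \ {0}] 0) (𝓝 0) ∧
    ∀ w : EuclideanSpace ℝ (Fin (n + 1)), ‖w‖ = 1 → (0 < t ∨ 0 ≤ Semigeodesic.height w) →
      Filter.Tendsto (fun s : ℝ => Semigeodesic.distQuotient (n := n) ι φ t y β (s • w)) (𝓝[>] 0)
        (𝓝 (-Semigeodesic.cubicTerm (n := n) ι r φ t y e w)) := by
  have hmain : Filter.Tendsto
      (fun u : EuclideanSpace ℝ (Fin (n + 1)) =>
        Semigeodesic.distQuotient (n := n) ι φ t y β u
          - (-Semigeodesic.cubicTerm (n := n) ι r φ t y e (‖u‖⁻¹ • u)))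
      (𝓝[Semigeodesic.cylinder n r t ρ h \ {0}] 0) (𝓝 0) := by
    have h1 := ((hβ.isLittleO_norm_sq_sub hι hφ ht hy).tendsto_div_nhds_zero).mono_left
      (nhdsWithin_mono _ (sdiff_subset (t := {0})))
    refine h1.congr' ?_
    filter_upwards [self_mem_nhdsWithin] with u hu
    have hu0 : ‖u‖ ≠ 0 := norm_ne_zero_iff.2 hu.2
    rw [hφ.cubicTerm_smul hι ht hy, Semigeodesic.distQuotient]
    field_simp
    ring
  refine ⟨hmain, fun w hw hwt => ?_⟩
  have hw0 : w ≠ 0 := by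
    rintro rfl
    simp at hw
  have hsw : Tendsto (fun s : ℝ => s • w) (𝓝[>] 0) (𝓝 0) := by
    have : Continuous fun s : ℝ => s • w := by fun_prop
    simpa using (this.tendsto 0).mono_left nhdsWithin_le_nhds
  -- When `t = 0`, the points `s • w` lie in the cylinder because the last coordinate of `w` is `≥ 0`.
  have hcyl : ∀ᶠ s : ℝ in 𝓝[>] 0, s • w ∈ Semigeodesic.cylinder n r t ρ h \ {0} := by
    have h1 := (Semigeodesic.tendsto_tang.comp hsw).norm.eventually_lt_const
      (show ‖(0 : EuclideanSpace ℝ (Fin n))‖ < ρ by simpa using hβ.radius_pos)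
    have h2 := (Semigeodesic.tendsto_height.comp hsw).abs.eventually_lt_const
      (show |(0 : ℝ)| < h by simpa using hβ.height_pos)
    have h3 := (Semigeodesic.tendsto_height.comp hsw).eventually_lt_const (sub_pos.2 ht.2)
    have h4 : ∀ᶠ s : ℝ in 𝓝[>] 0, 0 ≤ t + Semigeodesic.height (s • w) := by
      rcases hwt with ht0 | hw
      · filter_upwards [(Semigeodesic.tendsto_height.comp hsw).eventually_const_lt
          (neg_lt_zero.2 ht0)] with s hs
        simp only [Function.comp] at hs
        linarith
      · filter_upwards [self_mem_nhdsWithin] with s hs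
        rw [Semigeodesic.height_smul]
        exact add_nonneg ht.1 (mul_nonneg (le_of_lt hs) hw)
    filter_upwards [h1, h2, h3, h4, self_mem_nhdsWithin] with s e1 e2 e3 e4 hs
    simp only [Function.comp] at e1 e2 e3
    exact ⟨⟨e1, e2, e4, by linarith⟩, smul_ne_zero (ne_of_gt hs) hw0⟩
  have hlim := (hmain.comp (tendsto_nhdsWithin_iff.2 ⟨hsw, hcyl⟩)).add_const
    (-Semigeodesic.cubicTerm (n := n) ι r φ t y e w)
  rw [zero_add] at hlim
  refine hlim.congr' ?_
  filter_upwards [self_mem_nhdsWithin] with s hs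
  have hs0 : 0 < s := hs
  have hn : ‖s • w‖⁻¹ • s • w = w := by
    rw [norm_smul, hw, mul_one, Real.norm_of_nonneg hs0.le, inv_smul_smul₀ hs0.ne']
  simp only [Function.comp, hn]
  ring
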